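/- Let $A_2=\mathbb C[t_1,t_2]$, $\partial_i=\partial/\partial t_i$, $d_i=t_i\partial_i$ and $d=d_1+d_2$. Let $\bar S_2$ be the Lie algebra of derivations $\sum_i p_i\partial_i$ of $A_2$ ($p_i\in A_2$) with constant divergence $\sum_i\partial_i(p_i)\in\mathbb C$. Put $\bar S_2(k)=\{u\in\bar S_2 : [d,u]=ku\}$ and $\bar S_2^{\ge 0}=\bigoplus_{k\ge 0}\bar S_2(k)$, so that $\bar S_2=\Delta_2\oplus\bar S_2^{\ge0}$ with $\Delta_2=\bar S_2(-1)=\mathbb C\partial_1\oplus\mathbb C\partial_2$. Write $X\mapsto X_{\ge 0}$ for the projection of $\bar S_2$ onto $\bar S_2^{\ge 0}$ along $\Delta_2$. For $r\in\mathbb Z_+^2$ and $X\in\bar S_2$ put $\partial^rX=(\mathrm{ad}\,\partial_1)^{r_1}(\mathrm{ad}\,\partial_2)^{r_2}X$, which is zero for all but finitely many $r$. Let $\widetilde S_2=\bar S_2\ltimes A_2$ be the semidirect product Lie algebra in which $\bar S_2$ acts on the abelian Lie algebra $A_2$ by derivations. An $(A_2,\bar S_2)$-module is an $\widetilde S_2$-module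 $M$ on which $A_2$ acts associatively and unitally: $f(gm)=(fg)m$ and $1m=m$. Fix $\mathbf a=(a_1,a_2)\in\mathbb C^2$ and let $\phi_{\mathbf a}:\Delta_2\to\mathbb C$ be the Lie algebra homomorphism with $\phi_{\mathbf a}(\partial_i)=a_i$. For an $\widetilde S_2$-module $M$ let $\mathrm{Wh}_{\mathbf a}(M)=\{v\in M : xv=\phi_{\mathbf a}(x)v\ \ \forall x\in\Delta_2\}$. Let $\Omega^{\widetilde S_2}_{\mathbf a}$ be the full subcategory of the category of $\widetilde S_2$-modules whose objects are the $(A_2,\bar S_2)$-modules $M$ such that $\Delta_2$ acts locally finitely on $M$, for all $v\in M$ and $x\in\Delta_2$ there is $k$ with $(x-\phi_{\mathbf a}(x))^kv=0$, and $\dim\mathrm{Wh}_{\mathbf a}(M)<\infty$. For an $\bar S_2^{\ge0}$-module $V$ let $T(A_2^{\mathbf a},V)=A_2\otimes V$, where $f\in A_2$ acts by $f(p\otimes v)=fp\otimes v$ and $X=\sum_i p_i\partial_i\in\bar S_2$ acts by $$X(p\otimes v)=\sum_i p_i\,(\partial_i p+a_ip)\otimes v+\sum_{r\in\mathbb Z_+^2}\frac{t^r}{r!}\,p\otimes(\partial^rX)_{\ge0}\,v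 .$$ On a morphism $f$ put $T(A_2^{\mathbf a},f)=\mathrm{id}\otimes f$. Then, for every $\mathbf a\in\mathbb C^2$, the module $T(A_2^{\mathbf a},V)$ lies in $\Omega^{\widetilde S_2}_{\mathbf a}$ for every finite-dimensional $\bar S_2^{\ge0}$-module $V$, and the functor $V\mapsto T(A_2^{\mathbf a},V)$ is an equivalence from the category of finite-dimensional $\bar S_2^{\ge0}$-modules to $\Omega^{\widetilde S_2}_{\mathbf a}$. A quasi-inverse is the functor $M\mapsto\mathrm{Wh}_{\mathbf a}(M)$, where $X\in\bar S_2^{\ge0}$ acts on $\mathrm{Wh}_{\mathbf a}(M)$ by $$X\cdot v=\sum_{r\in\mathbb Z_+^2}(-1)^{|r|}\frac{t^r}{r!}\,\big((\partial^rX)\,v\big),$$ and morphisms are restricted to Whittaker vectors. -/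

import Mathlib

universe w u

namespace WhittakerS2

open MvPolynomial TensorProduct CategoryTheory

/-- The polynomial algebra `A₂ = ℂ[t₁, t₂]`; the variable `t_{i+1}` is `X i`. -/
abbrev A2 : Type := MvPolynomial (Fin 2) ℂ

/-- The Witt algebra `W₂` of derivations of `A₂`. A derivation `D` is `∑ i, D (X i) • ∂_i`. -/
abbrev W2 : Type := Derivation ℂ A2 A2

/-- The divergence `∑ i, ∂_i (p_i)` of `D = ∑ i, p_i ∂_i`. -/
noncomputable def divergence : W2 →ₗ[ℂ] A2 where
  toFun D := ∑ i, pderiv i (D (X i))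
  map_add' D E := by simp [Finset.sum_add_distrib]
  map_smul' c D := by simp

lemma W2_apply (D : W2) (f : A2) : D f = ∑ i, D (X i) * pderiv i f := by
  have h : D = ∑ i, D (X i) • (pderiv i : W2) := by
    refine MvPolynomial.derivation_ext fun j => ?_
    simp [Fin.sum_univ_two, pderiv_X, Pi.single_apply]
    fin_cases j <;> simp
  conv_lhs => rw [h]
  simp [Fin.sum_univ_two]

lemma pderiv_comm' (i j : Fin 2) (f : A2) : pderiv i (pderiv j f) = pderiv j (pderiv i f) := by
  have h : ⁅(pderiv i : W2), (pderiv j : W2)⁆ = 0 := by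
    refine MvPolynomial.derivation_ext fun k => ?_
    rw [Derivation.commutator_apply]
    by_cases h1 : k = i <;> by_cases h2 : k = j <;> simp [pderiv_X, Pi.single_apply, h1, h2] <;> split_ifs <;> simp
  have := congrArg (fun D : W2 => D f) h
  simpa [Derivation.commutator_apply, sub_eq_zero] using this

lemma divergence_lie (D E : W2) :
    divergence ⁅D, E⁆ = D (divergence E) - E (divergence D) := by
  simp only [divergence, LinearMap.coe_mk, AddHom.coe_mk, Derivation.commutator_apply, map_sub,
    map_sum]
  simp only [W2_apply D (E _), W2_apply E (D _), W2_apply D (pderiv _ _), W2_apply E (pderiv _ _)]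
  simp only [Fin.sum_univ_two, map_add, pderiv_mul]
  simp only [pderiv_comm' 1 0]
  ring

/-- The Lie algebra `S̄₂` of derivations of `A₂` with constant divergence. -/
noncomputable def Sbar : LieSubalgebra ℂ W2 where
  carrier := {D | ∃ c : ℂ, divergence D = C c}
  zero_mem' := ⟨0, by simp⟩
  add_mem' := by
    rintro D E ⟨c, hc⟩ ⟨d, hd⟩
    exact ⟨c + d, by simp [hc, hd]⟩
  smul_mem' := by
    rintro r D ⟨c, hc⟩
    exact ⟨r * c, by simp [hc, smul_eq_C_mul]⟩
  lie_mem' := by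
    rintro D E ⟨c, hc⟩ ⟨d, hd⟩
    refine ⟨0, ?_⟩
    rw [divergence_lie, hc, hd]; simp

/-- `∂_i` as an element of `S̄₂`. -/
noncomputable def partialS (i : Fin 2) : Sbar :=
  ⟨pderiv i, 0, by
    simp only [divergence, LinearMap.coe_mk, AddHom.coe_mk, Fin.sum_univ_two, pderiv_X]
    fin_cases i <;> simp⟩

/-- `d = t₁∂₁ + t₂∂₂` as an element of `S̄₂`. -/
noncomputable def eulerS : Sbar :=
  ⟨∑ i, (X i : A2) • (pderiv i : W2), 2, by
    simp [divergence, Fin.sum_univ_two, pderiv_X, map_ofNat]; norm_num⟩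

/-- The homogeneous part `S̄₂(k) = {u | [d, u] = k u}`. -/
noncomputable def gradeS (k : ℤ) : Submodule ℂ Sbar where
  carrier := {u | ⁅eulerS, u⁆ = (k : ℂ) • u}
  zero_mem' := by simp
  add_mem' := by
    intro u v hu hv
    simp only [Set.mem_ofPred_eq] at *
    rw [lie_add, hu, hv, smul_add]
  smul_mem' := by
    intro c u hu
    simp only [Set.mem_ofPred_eq] at *
    rw [lie_smul, hu, smul_comm]

/-- The parabolic subalgebra `S̄₂^{≥0} = ⨁_{k ≥ 0} S̄₂(k)`. (Eigenspaces for distinct eigenvalues are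
automatically independent, so the sum is direct.) -/
noncomputable def SbarGE : LieSubalgebra ℂ Sbar where
  toSubmodule := ⨆ k : ℕ, gradeS k
  lie_mem' := by
    intro x y hx hy
    change x ∈ ⨆ k : ℕ, gradeS k at hx
    change y ∈ ⨆ k : ℕ, gradeS k at hy
    change ⁅x, y⁆ ∈ ⨆ k : ℕ, gradeS k
    induction hx using Submodule.iSup_induction' with
    | mem i x hx =>
      induction hy using Submodule.iSup_induction' with
      | mem j y hy =>
        refine Submodule.mem_iSup_of_mem (i + j) ?_
        change ⁅eulerS, x⁆ = ((i : ℤ) : ℂ) • x at hx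
        change ⁅eulerS, y⁆ = ((j : ℤ) : ℂ) • y at hy
        change ⁅eulerS, ⁅x, y⁆⁆ = (((i + j : ℕ) : ℤ) : ℂ) • ⁅x, y⁆
        rw [leibniz_lie, hx, hy, smul_lie, lie_smul, ← add_smul]
        push_cast; rfl
      | zero => simp
      | add a b _ _ ha hb => rw [lie_add]; exact add_mem ha hb
    | zero => simp
    | add a b _ _ ha hb => rw [add_lie]; exact add_mem ha hb

/-- The coefficient `p_i` of `D = ∑ i, p_i ∂_i`. -/
noncomputable def component (i : Fin 2) : Sbar →ₗ[ℂ] A2 where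
  toFun D := D.1 (X i)
  map_add' _ _ := rfl
  map_smul' _ _ := rfl

/-- The value at the origin of the coefficient `p_i` of `D = ∑ i, p_i ∂_i`. -/
noncomputable def atOrigin (i : Fin 2) : Sbar →ₗ[ℂ] ℂ :=
  lcoeff ℂ 0 ∘ₗ component i

lemma atOrigin_apply (i : Fin 2) (D : Sbar) : atOrigin i D = coeff 0 (D.1 (X i)) := rfl

lemma Sbar_ext {D E : Sbar} (h : ∀ i, D.1 (X i) = E.1 (X i)) : D = E :=
  Subtype.ext (MvPolynomial.derivation_ext h)

lemma lie_apply_X (D E : Sbar) (i : Fin 2) :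
    (⁅D, E⁆ : Sbar).1 (X i) = D.1 (E.1 (X i)) - E.1 (D.1 (X i)) := rfl

lemma euler_apply (f : A2) : eulerS.1 f = ∑ i, X i * pderiv i f := by
  simp [eulerS]

/-- The part of degree `k` of a vector field with constant divergence. -/
noncomputable def homComp (k : ℕ) (D : Sbar) : Sbar :=
  ⟨mkDerivation ℂ fun i => homogeneousComponent (k + 1) (D.1 (X i)), by
    obtain ⟨D, c, hc⟩ := D
    have key : ∀ f : A2, ∀ i, pderiv i (homogeneousComponent (k + 1) f)
        = homogeneousComponent k (pderiv i f) := by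
      intro f i
      ext m
      simp only [coeff_pderiv, coeff_homogeneousComponent]
      simp only [map_add, Finsupp.degree_single, add_left_inj]
      split_ifs <;> simp
    refine ⟨if k = 0 then c else 0, ?_⟩
    have : divergence (mkDerivation ℂ fun i => homogeneousComponent (k + 1) (D (X i)))
        = homogeneousComponent k (divergence D) := by
      simp [divergence, key]
    change divergence (mkDerivation ℂ fun i => homogeneousComponent (k + 1) (D (X i))) = _
    rw [this, hc, homogeneousComponent_of_mem (isHomogeneous_C _ c)]
    split_ifs <;> simp⟩

lemma mem_SbarGE {D : Sbar} (h : ∀ i, atOrigin i D = 0) : D ∈ SbarGE := by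
  have hgr : ∀ k : ℕ, homComp k D ∈ gradeS k := by
    intro k
    change ⁅eulerS, homComp k D⁆ = ((k : ℤ) : ℂ) • homComp k D
    refine Sbar_ext fun i => ?_
    rw [lie_apply_X, euler_apply]
    have h1 : eulerS.1 (X i) = X i := by
      rw [euler_apply]; simp only [Fin.sum_univ_two, pderiv_X]; fin_cases i <;> simp
    have h2 : (homComp k D).1 (X i) = homogeneousComponent (k + 1) (D.1 (X i)) := by
      simp [homComp, mkDerivation_X]
    rw [h1, h2, (homogeneousComponent_isHomogeneous (k+1) _).sum_X_mul_pderiv]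
    change _ = ((k : ℤ) : ℂ) • (homComp k D).1 (X i)
    rw [h2]
    simp [add_smul, smul_eq_C_mul]
  have hsum : D = ∑ k ∈ Finset.range ((D.1 (X 0)).totalDegree + (D.1 (X 1)).totalDegree), homComp k D := by
    refine Sbar_ext fun i => ?_
    have h3 : component i (∑ k ∈ Finset.range ((D.1 (X 0)).totalDegree +
        (D.1 (X 1)).totalDegree), homComp k D)
        = ∑ k ∈ Finset.range ((D.1 (X 0)).totalDegree + (D.1 (X 1)).totalDegree),
          (homogeneousComponent (k+1) (D.1 (X i))) := by
      rw [map_sum]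
      exact Finset.sum_congr rfl fun k _ => by simp [component, homComp, mkDerivation_X]
    change _ = component i _
    rw [h3]
    ext m
    simp only [coeff_sum, coeff_homogeneousComponent]
    by_cases hm : m = 0
    · have := h i
      rw [atOrigin_apply] at this
      subst hm
      simp [this]
    · have hm' : m.degree ≠ 0 := by simpa [Finsupp.degree_eq_zero_iff] using hm
      obtain ⟨n, hn⟩ := Nat.exists_eq_succ_of_ne_zero hm'
      simp only [hn, Nat.succ_eq_add_one, add_left_inj]
      rw [Finset.sum_ite_eq]
      split_ifs with hlt
      · rfl
      · apply coeff_eq_zero_of_totalDegree_lt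
        rw [Finset.mem_range] at hlt
        have : m.degree = ∑ i ∈ m.support, m i := rfl
        rw [← this, hn]
        fin_cases i <;> simp <;> omega
  rw [hsum]
  exact sum_mem fun k _ => Submodule.mem_iSup_of_mem (p := fun k : ℕ => gradeS k) k (hgr k)

lemma atOrigin_of_mem {D : Sbar} (h : D ∈ SbarGE) (i : Fin 2) : atOrigin i D = 0 := by
  change D ∈ ⨆ k : ℕ, gradeS k at h
  induction h using Submodule.iSup_induction' with
  | mem k D hD =>
    change ⁅eulerS, D⁆ = ((k : ℤ) : ℂ) • D at hD
    have := congrArg (atOrigin i) hD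
    have h1 : eulerS.1 (X i) = X i := by
      rw [euler_apply]; simp only [Fin.sum_univ_two, pderiv_X]; fin_cases i <;> simp
    rw [map_smul, atOrigin_apply, atOrigin_apply, lie_apply_X, euler_apply, h1] at this
    rw [atOrigin_apply]
    simp only [← constantCoeff_eq, map_sub, map_sum, map_mul, constantCoeff_X] at this
    simp only [← constantCoeff_eq]
    simp at this
    have hk : ((k : ℂ) + 1) ≠ 0 := by exact_mod_cast Nat.succ_ne_zero k
    have h2 : ((k : ℂ) + 1) * constantCoeff (D.1 (X i)) = 0 := by linear_combination -this
    exact (mul_eq_zero.mp h2).resolve_left hk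
  | zero => simp
  | add a b _ _ ha hb => rw [map_add, ha, hb, add_zero]


/-- `ad ∂_i` on `S̄₂`; it differentiates the coefficients of a vector field. -/
noncomputable def adPartial (i : Fin 2) : Module.End ℂ Sbar := LieAlgebra.ad ℂ Sbar (partialS i)

lemma component_adPartial (i j : Fin 2) (D : Sbar) :
    component j (adPartial i D) = pderiv i (component j D) := by
  change (⁅partialS i, D⁆ : Sbar).1 (X j) = pderiv i (D.1 (X j))
  rw [lie_apply_X]
  change pderiv i (D.1 (X j)) - D.1 (pderiv i (X j)) = _
  rw [pderiv_X, Pi.single_apply]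
  split_ifs <;> simp

lemma adPartial_comm (i j : Fin 2) : Commute (adPartial i) (adPartial j) := by
  refine LinearMap.ext fun D => Sbar_ext fun k => ?_
  change component k (adPartial i (adPartial j D)) = component k (adPartial j (adPartial i D))
  simp only [component_adPartial]
  exact pderiv_comm' _ _ _

/-- `∂^r D := (ad ∂₁)^{r₁} (ad ∂₂)^{r₂} D`. -/
noncomputable def iterAd (r : Fin 2 →₀ ℕ) : Module.End ℂ Sbar :=
  adPartial 0 ^ r 0 * adPartial 1 ^ r 1

lemma iterAd_zero : iterAd 0 = 1 := by simp [iterAd]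

lemma iterAd_add_single (r : Fin 2 →₀ ℕ) (i : Fin 2) :
    iterAd (r + Finsupp.single i 1) = adPartial i * iterAd r := by
  fin_cases i
  · simp [iterAd, pow_succ', mul_assoc]
  · simp only [iterAd, Finsupp.add_apply]
    simp [pow_succ']
    rw [← mul_assoc, ← mul_assoc, ((adPartial_comm 0 1).pow_left _).eq]

lemma adPartial_locally_nilpotent (i : Fin 2) (D : Sbar) :
    ∃ N : ℕ, ∀ n ≥ N, (adPartial i ^ n) D = 0 := by
  have h : ∀ (n : ℕ) (f : A2) (m : Fin 2 →₀ ℕ), f.totalDegree < n →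
      coeff m ((pderiv i)^[n] f) = 0 := by
    have h' : ∀ (n : ℕ) (f : A2), (∀ m : Fin 2 →₀ ℕ, n ≤ m i → coeff m f = 0) →
        (pderiv i)^[n] f = 0 := by
      intro n
      induction n with
      | zero => intro f hf; ext m; simpa using hf m (Nat.zero_le _)
      | succ n ih =>
        intro f hf
        rw [Function.iterate_succ_apply]
        refine ih _ fun m hm => ?_
        rw [coeff_pderiv, hf _ (by simpa using hm), zero_mul]
    intro n f m hn
    rw [h' n f, coeff_zero]
    intro m hm
    apply coeff_eq_zero_of_totalDegree_lt
    refine lt_of_lt_of_le hn (hm.trans ?_)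
    exact Finsupp.le_degree i m
  refine ⟨(component 0 D).totalDegree + (component 1 D).totalDegree + 1, fun n hn => ?_⟩
  refine Sbar_ext fun j => ?_
  change component j _ = component j 0
  have h2 : ∀ (n : ℕ) (D : Sbar), component j ((adPartial i ^ n) D)
      = (pderiv i)^[n] (component j D) := by
    intro n
    induction n with
    | zero => intro D; simp
    | succ n ih =>
      intro D
      rw [pow_succ, Module.End.mul_apply, ih, component_adPartial, Function.iterate_succ_apply]
  rw [h2, map_zero]
  ext m
  rw [h n _ m, coeff_zero]
  fin_cases j <;> simp <;> omega

lemma iterAd_finite (D : Sbar) : {r : Fin 2 →₀ ℕ | iterAd r D ≠ 0}.Finite := by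
  obtain ⟨N, hN⟩ := adPartial_locally_nilpotent 0 D
  obtain ⟨M, hM⟩ := adPartial_locally_nilpotent 1 D
  refine (Set.finite_Iic (Finsupp.single 0 N + Finsupp.single 1 M)).subset fun r hr => ?_
  rw [Set.mem_Iic, Finsupp.le_def]
  intro i
  by_contra hlt
  apply hr
  fin_cases i
  · simp at hlt
    rw [iterAd, ((adPartial_comm 0 1).pow_pow _ _).eq, Module.End.mul_apply, hN _ hlt.le, map_zero]
  · simp at hlt
    rw [iterAd, Module.End.mul_apply, hM _ hlt.le, map_zero]

/-- The (finite) Taylor sum `∑_r c^{|r|} (t^r / r!) ⊗ ∂^r D` in `A₂ ⊗ S̄₂`. On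
`L_α = (1+α₂) t^{α+e₁} ∂₁ - (1+α₁) t^{α+e₂} ∂₂` and `c = 1` it is
`∑_{0 ≤ r ≤ α+e₁+e₂} binom(α+e₁+e₂, r) t^r ⊗ L_{α-r}`. -/
noncomputable def taylor (c : ℂ) (D : Sbar) : A2 ⊗[ℂ] Sbar :=
  ∑ᶠ r : Fin 2 →₀ ℕ,
    (monomial r (c ^ r.degree / ((r 0).factorial * (r 1).factorial)) : A2) ⊗ₜ[ℂ] iterAd r D

section coeffs
variable {L : Type*} [AddCommGroup L] [Module ℂ L]

/-- The coefficient of `t^r` of an element of `A₂ ⊗ L = L[t₁, t₂]`. -/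
noncomputable def tcoeff (r : Fin 2 →₀ ℕ) : A2 ⊗[ℂ] L →ₗ[ℂ] L :=
  (TensorProduct.lid ℂ L).toLinearMap ∘ₗ LinearMap.rTensor L (lcoeff ℂ r)

lemma tcoeff_tmul (r : Fin 2 →₀ ℕ) (f : A2) (x : L) : tcoeff r (f ⊗ₜ[ℂ] x) = coeff r f • x := rfl

lemma tcoeff_ext {z w : A2 ⊗[ℂ] L} (h : ∀ r, tcoeff r z = tcoeff r w) : z = w := by
  classical
  apply (TensorProduct.equivFinsuppOfBasisLeft (basisMonomials (Fin 2) ℂ) (N := L)).injective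
  ext r
  rw [TensorProduct.equivFinsuppOfBasisLeft_apply, TensorProduct.equivFinsuppOfBasisLeft_apply]
  exact h r

lemma tcoeff_pderiv (r : Fin 2 →₀ ℕ) (i : Fin 2) (z : A2 ⊗[ℂ] L) :
    tcoeff r (LinearMap.rTensor L (pderiv i : W2).toLinearMap z) =
      ((r i : ℂ) + 1) • tcoeff (r + Finsupp.single i 1) z := by
  induction z with
  | zero => simp
  | tmul f x =>
    simp only [LinearMap.rTensor_tmul, tcoeff_tmul, Derivation.coeFn_coe, coeff_pderiv, smul_smul,
      mul_comm]
  | add a b ha hb => simp only [map_add, smul_add, ha, hb]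

lemma tcoeff_lTensor {L' : Type*} [AddCommGroup L'] [Module ℂ L'] (g : L →ₗ[ℂ] L')
    (r : Fin 2 →₀ ℕ) (z : A2 ⊗[ℂ] L) :
    tcoeff r (LinearMap.lTensor A2 g z) = g (tcoeff r z) := by
  induction z with
  | zero => simp
  | tmul f x => simp [tcoeff_tmul]
  | add a b ha hb => simp only [map_add, ha, hb]

lemma multi_induction {P : (Fin 2 →₀ ℕ) → Prop} (h0 : P 0)
    (hs : ∀ r i, P r → P (r + Finsupp.single i 1)) (r : Fin 2 →₀ ℕ) : P r := by
  have key : ∀ (i : Fin 2) (n : ℕ) (s : Fin 2 →₀ ℕ), P s → P (s + Finsupp.single i n) := by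
    intro i n
    induction n with
    | zero => intro s hs; simpa using hs
    | succ n ih =>
      intro s hs'
      rw [Finsupp.single_add, ← add_assoc]
      exact hs _ _ (ih s hs')
  have hr : r = 0 + Finsupp.single 0 (r 0) + Finsupp.single 1 (r 1) := by
    ext i; fin_cases i <;> simp
  rw [hr]
  exact key _ _ _ (key _ _ _ h0)

end coeffs

lemma tcoeff_taylor (c : ℂ) (D : Sbar) (r : Fin 2 →₀ ℕ) :
    tcoeff r (taylor c D) = (c ^ r.degree / ((r 0).factorial * (r 1).factorial)) • iterAd r D := by
  rw [taylor, show ∀ z, tcoeff r z = (tcoeff r).toAddMonoidHom z from fun _ => rfl,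
    AddMonoidHom.map_finsum]
  · rw [finsum_eq_single _ r]
    · simp [tcoeff_tmul]
    · intro s hs
      simp [tcoeff_tmul, coeff_monomial, hs]
  · refine (iterAd_finite D).subset fun s hs hz => hs ?_
    simp only [hz, TensorProduct.tmul_zero]

/-- `taylor c` as a linear map. -/
noncomputable def taylorₗ (c : ℂ) : Sbar →ₗ[ℂ] A2 ⊗[ℂ] Sbar where
  toFun := taylor c
  map_add' D E := tcoeff_ext fun r => by simp only [map_add, tcoeff_taylor, smul_add]
  map_smul' a D := tcoeff_ext fun r => by
    simp only [map_smul, tcoeff_taylor, RingHom.id_apply]; rw [smul_comm]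

lemma pderiv_taylor (c : ℂ) (D : Sbar) (i : Fin 2) :
    LinearMap.rTensor Sbar (pderiv i : W2).toLinearMap (taylor c D)
      = c • LinearMap.lTensor A2 (adPartial i) (taylor c D) := by
  refine tcoeff_ext fun r => ?_
  rw [tcoeff_pderiv, map_smul, tcoeff_lTensor, tcoeff_taylor, tcoeff_taylor, iterAd_add_single,
    map_smul, smul_smul, smul_smul, Module.End.mul_apply]
  congr 1
  have h0 : ((r 0).factorial : ℂ) ≠ 0 := by exact_mod_cast Nat.factorial_ne_zero _
  have h1 : ((r 1).factorial : ℂ) ≠ 0 := by exact_mod_cast Nat.factorial_ne_zero _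
  have h2 : ((r 0 : ℂ) + 1) ≠ 0 := Nat.cast_add_one_ne_zero _
  have h3 : ((r 1 : ℂ) + 1) ≠ 0 := Nat.cast_add_one_ne_zero _
  fin_cases i <;> simp [Nat.factorial_succ, pow_succ] <;> field_simp

lemma taylor_unique (c : ℂ) (z : A2 ⊗[ℂ] Sbar) (h0 : tcoeff 0 z = 0)
    (h : ∀ i, LinearMap.rTensor Sbar (pderiv i : W2).toLinearMap z
      = c • LinearMap.lTensor A2 (adPartial i) z) : z = 0 := by
  refine tcoeff_ext fun r => ?_
  rw [map_zero]
  induction r using multi_induction with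
  | h0 => exact h0
  | hs r i ih =>
    have := congrArg (tcoeff r) (h i)
    rw [tcoeff_pderiv, map_smul, tcoeff_lTensor, ih, map_zero, smul_zero] at this
    exact (smul_eq_zero.mp this).resolve_left (Nat.cast_add_one_ne_zero _)

/-- For an `L`-module `V`, the action `(f ⊗ x) (g ⊗ v) = f g ⊗ x v` of `A₂ ⊗ L` on `A₂ ⊗ V`. -/
noncomputable def extAct (L V : Type*) [LieRing L] [LieAlgebra ℂ L] [AddCommGroup V] [Module ℂ V]
    [LieRingModule L V] [LieModule ℂ L V] :
    A2 ⊗[ℂ] L →ₗ[ℂ] A2 ⊗[ℂ] V →ₗ[ℂ] A2 ⊗[ℂ] V :=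
  TensorProduct.map₂ (LinearMap.mul ℂ A2) (LieModule.toEnd ℂ L V : L →ₗ[ℂ] Module.End ℂ V)

section extAct
variable {L V : Type*} [LieRing L] [LieAlgebra ℂ L] [AddCommGroup V] [Module ℂ V]
    [LieRingModule L V] [LieModule ℂ L V]

lemma extAct_tmul (f g : A2) (x : L) (v : V) :
    extAct L V (f ⊗ₜ x) (g ⊗ₜ v) = (f * g) ⊗ₜ[ℂ] ⁅x, v⁆ := rfl

lemma extAct_leibniz (z w : A2 ⊗[ℂ] L) (u : A2 ⊗[ℂ] V) :
    extAct L V z (extAct L V w u) =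
      extAct L V (extAct L L z w) u + extAct L V w (extAct L V z u) := by
  induction z with
  | zero => simp
  | add a b ha hb => simp only [map_add, LinearMap.add_apply, ha, hb]; abel
  | tmul f x =>
    induction w with
    | zero => simp
    | add a b ha hb => simp only [map_add, LinearMap.add_apply, ha, hb]; abel
    | tmul g y =>
      induction u with
      | zero => simp
      | add a b ha hb => simp only [map_add, ha, hb]; abel
      | tmul h v =>
        simp only [extAct_tmul]
        rw [leibniz_lie, TensorProduct.tmul_add, mul_assoc, mul_left_comm g f]

lemma extAct_derivation (D : W2) (z : A2 ⊗[ℂ] L) (u : A2 ⊗[ℂ] V) :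
    LinearMap.rTensor V D.toLinearMap (extAct L V z u) =
      extAct L V (LinearMap.rTensor L D.toLinearMap z) u +
      extAct L V z (LinearMap.rTensor V D.toLinearMap u) := by
  induction z with
  | zero => simp
  | add a b ha hb => simp only [map_add, LinearMap.add_apply, ha, hb]; abel
  | tmul f x =>
    induction u with
    | zero => simp
    | add a b ha hb => simp only [map_add, ha, hb]; abel
    | tmul g y =>
      simp only [extAct_tmul, LinearMap.rTensor_tmul,
        Derivation.coeFn_coe, Derivation.leibniz, smul_eq_mul, TensorProduct.add_tmul]
      rw [add_comm, mul_comm g]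

end extAct

lemma lTensor_lie (i : Fin 2) (z w : A2 ⊗[ℂ] Sbar) :
    LinearMap.lTensor A2 (adPartial i) (extAct Sbar Sbar z w) =
      extAct Sbar Sbar (LinearMap.lTensor A2 (adPartial i) z) w +
      extAct Sbar Sbar z (LinearMap.lTensor A2 (adPartial i) w) := by
  induction z with
  | zero => simp
  | add a b ha hb => simp only [map_add, LinearMap.add_apply, ha, hb]; abel
  | tmul f x =>
    induction w with
    | zero => simp
    | add a b ha hb => simp only [map_add, ha, hb]; abel
    | tmul g y =>
      simp only [extAct_tmul, LinearMap.lTensor_tmul,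
        adPartial, LieAlgebra.ad_apply]
      rw [leibniz_lie, TensorProduct.tmul_add]

lemma tcoeff_zero_lie (z w : A2 ⊗[ℂ] Sbar) :
    tcoeff 0 (extAct Sbar Sbar z w) = ⁅tcoeff 0 z, tcoeff 0 w⁆ := by
  induction z with
  | zero => simp
  | add a b ha hb => simp only [map_add, LinearMap.add_apply, add_lie, ha, hb]
  | tmul f x =>
    induction w with
    | zero => simp
    | add a b ha hb => simp only [map_add, lie_add, ha, hb]
    | tmul g y =>
      simp only [extAct_tmul, tcoeff_tmul, smul_lie, lie_smul, smul_smul]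
      simp only [← constantCoeff_eq, map_mul, mul_comm]

lemma tcoeff_zero_taylor (c : ℂ) (D : Sbar) : tcoeff 0 (taylor c D) = D := by
  rw [tcoeff_taylor, iterAd_zero]; simp

lemma taylor_lie (c : ℂ) (D E : Sbar) :
    taylor c ⁅D, E⁆ = extAct Sbar Sbar (taylor c D) (taylor c E) := by
  rw [← sub_eq_zero]
  refine taylor_unique c _ ?_ fun i => ?_
  · rw [map_sub, tcoeff_zero_lie]; simp only [tcoeff_zero_taylor, sub_self]
  · rw [map_sub, map_sub, extAct_derivation, lTensor_lie]
    simp only [pderiv_taylor, map_smul, LinearMap.smul_apply, smul_sub, smul_add]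

lemma sub_constant_mem (D : Sbar) : D - ∑ i, atOrigin i D • partialS i ∈ SbarGE := by
  refine mem_SbarGE fun j => ?_
  have h : ∀ i, atOrigin j (partialS i) = if j = i then 1 else 0 := by
    intro i
    rw [atOrigin_apply]
    change coeff 0 (pderiv i (X j)) = _
    rw [pderiv_X, Pi.single_apply]
    split_ifs <;> simp
  simp only [map_sub, map_sum, map_smul, h, smul_eq_mul, mul_ite, mul_one, mul_zero,
    Finset.sum_ite_eq, Finset.mem_univ, if_true, sub_self]

/-- The projection `S̄₂ → S̄₂^{≥0}` along `S̄₂(-1) = ℂ∂₁ ⊕ ℂ∂₂`: drop the constant part. -/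
noncomputable def projGE : Sbar →ₗ[ℂ] SbarGE where
  toFun D := ⟨D - ∑ i, atOrigin i D • partialS i, sub_constant_mem D⟩
  map_add' D E := Subtype.ext (by
    change _ = (D - ∑ i, atOrigin i D • partialS i) + (E - ∑ i, atOrigin i E • partialS i)
    simp only [map_add, add_smul, Finset.sum_add_distrib]; abel)
  map_smul' c D := Subtype.ext (by
    change _ = c • (D - ∑ i, atOrigin i D • partialS i)
    simp only [map_smul, smul_sub, Finset.smul_sum, smul_assoc])

lemma projGE_coe (D : Sbar) :
    (projGE D : Sbar) = D - ∑ i, atOrigin i D • partialS i := rfl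

lemma projGE_of_mem (x : SbarGE) : projGE x = x := by
  apply Subtype.ext
  rw [projGE_coe]
  simp [atOrigin_of_mem x.2]

lemma atOrigin_iterAd (j : Fin 2) (r : Fin 2 →₀ ℕ) : ∀ D : Sbar,
    atOrigin j (iterAd r D) = ((r 0).factorial * (r 1).factorial) * coeff r (component j D) := by
  induction r using multi_induction with
  | h0 => intro D; simp [iterAd_zero]; rfl
  | hs r i ih =>
    intro D
    have h : Commute (adPartial i) (iterAd r) :=
      Commute.mul_right ((adPartial_comm i 0).pow_right _) ((adPartial_comm i 1).pow_right _)
    rw [iterAd_add_single, h.eq, Module.End.mul_apply, ih, component_adPartial, coeff_pderiv]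
    fin_cases i <;> simp [Nat.factorial_succ] <;> ring

/-- The element `∑ i, p_i ⊗ ∂_i` of `A₂ ⊗ S̄₂` for `D = ∑ i, p_i ∂_i`. -/
noncomputable def constPart (D : Sbar) : A2 ⊗[ℂ] Sbar := ∑ i, component i D ⊗ₜ[ℂ] partialS i

/-- The `A₂ ⊗ S̄₂^{≥0}` part of the image of `D ∈ S̄₂` under the isomorphism
`A₂ # U(S̄₂) ≅ 𝒟₂ ⊗ U(S̄₂^{≥0})`, namely `∑_r (t^r / r!) ⊗ (∂^r D)_{≥0}`. For `L_α` it is the sum of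
`binom(α+e₁+e₂, r) t^r ⊗ L_{α-r}` over the `r` with `0 ≤ r ≤ α+e₁+e₂` and `|α-r| ≥ 0`; for
`d_i = t_i∂_i` it is `1 ⊗ d_i`. -/
noncomputable def cocycle : Sbar →ₗ[ℂ] A2 ⊗[ℂ] SbarGE :=
  LinearMap.lTensor A2 projGE ∘ₗ taylorₗ 1

lemma cocycle_apply (D : Sbar) : cocycle D = LinearMap.lTensor A2 projGE (taylor 1 D) := rfl

lemma taylor_decomp (D : Sbar) :
    taylor 1 D = LinearMap.lTensor A2 SbarGE.toSubmodule.subtype (cocycle D) + constPart D := by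
  refine tcoeff_ext fun r => ?_
  rw [map_add, tcoeff_lTensor, cocycle_apply, tcoeff_lTensor]
  change _ = ((projGE (tcoeff r (taylor 1 D)) : SbarGE) : Sbar) + _
  rw [projGE_coe]
  have h0 : ((r 0).factorial : ℂ) ≠ 0 := by exact_mod_cast Nat.factorial_ne_zero _
  have h1 : ((r 1).factorial : ℂ) ≠ 0 := by exact_mod_cast Nat.factorial_ne_zero _
  have h : tcoeff r (constPart D) = ∑ i, atOrigin i (tcoeff r (taylor 1 D)) • partialS i := by
    simp only [constPart, map_sum, tcoeff_tmul, tcoeff_taylor, map_smul, atOrigin_iterAd]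
    refine Finset.sum_congr rfl fun i _ => ?_
    congr 1
    simp; field_simp
  rw [h]; abel

lemma extAct_skew {L : Type*} [LieRing L] [LieAlgebra ℂ L] (z w : A2 ⊗[ℂ] L) :
    extAct L L z w = - extAct L L w z := by
  induction z with
  | zero => simp
  | add a b ha hb => simp only [map_add, LinearMap.add_apply, ha, hb]; abel
  | tmul f x =>
    induction w with
    | zero => simp
    | add a b ha hb => simp only [map_add, LinearMap.add_apply, ha, hb]; abel
    | tmul g y =>
      simp only [extAct_tmul]
      rw [← lie_skew, TensorProduct.tmul_neg, mul_comm]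

lemma extAct_tmul_partial (f : A2) (i : Fin 2) (w : A2 ⊗[ℂ] Sbar) :
    extAct Sbar Sbar (f ⊗ₜ partialS i) w = f • LinearMap.lTensor A2 (adPartial i) w := by
  induction w with
  | zero => simp
  | add a b ha hb => simp only [map_add, smul_add, ha, hb]
  | tmul g y => simp [extAct_tmul, adPartial, TensorProduct.smul_tmul']

lemma rTensor_eq_sum {L : Type*} [AddCommGroup L] [Module ℂ L] (D : W2) (z : A2 ⊗[ℂ] L) :
    LinearMap.rTensor L D.toLinearMap z =
      ∑ i, D (X i) • LinearMap.rTensor L (pderiv i : W2).toLinearMap z := by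
  induction z with
  | zero => simp
  | add a b ha hb => simp only [map_add, smul_add, ha, hb, Finset.sum_add_distrib]
  | tmul g y =>
    simp only [LinearMap.rTensor_tmul, Derivation.coeFn_coe, TensorProduct.smul_tmul', smul_eq_mul]
    rw [← TensorProduct.sum_tmul, ← W2_apply]

lemma adPartial_partial (i j : Fin 2) : adPartial i (partialS j) = 0 := by
  refine Sbar_ext fun k => ?_
  change component k (adPartial i (partialS j)) = 0
  rw [component_adPartial]
  change pderiv i (pderiv j (X k)) = 0
  rw [pderiv_X, Pi.single_apply]
  split_ifs <;> simp

lemma extAct_constPart_taylor (D E : Sbar) :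
    extAct Sbar Sbar (constPart D) (taylor 1 E)
      = LinearMap.rTensor Sbar D.1.toLinearMap (taylor 1 E) := by
  rw [rTensor_eq_sum]
  simp only [constPart, map_sum, LinearMap.sum_apply, extAct_tmul_partial]
  refine Finset.sum_congr rfl fun i _ => ?_
  rw [pderiv_taylor, one_smul]; rfl

lemma extAct_constPart_constPart (D E : Sbar) :
    extAct Sbar Sbar (constPart D) (constPart E) = 0 := by
  simp only [constPart, map_sum, LinearMap.sum_apply, extAct_tmul, partialS]
  refine Finset.sum_eq_zero fun i _ => Finset.sum_eq_zero fun j _ => ?_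
  have := adPartial_partial j i
  rw [adPartial, LieAlgebra.ad_apply] at this
  change _ ⊗ₜ[ℂ] ⁅partialS j, partialS i⁆ = 0
  rw [this, TensorProduct.tmul_zero]

lemma projGE_extAct (z w : A2 ⊗[ℂ] SbarGE) :
    LinearMap.lTensor A2 projGE (extAct Sbar Sbar
      (LinearMap.lTensor A2 SbarGE.toSubmodule.subtype z)
      (LinearMap.lTensor A2 SbarGE.toSubmodule.subtype w)) = extAct SbarGE SbarGE z w := by
  induction z with
  | zero => simp
  | add a b ha hb => simp only [map_add, LinearMap.add_apply, ha, hb]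
  | tmul f x =>
    induction w with
    | zero => simp
    | add a b ha hb => simp only [map_add, ha, hb]
    | tmul g y =>
      simp only [extAct_tmul, LinearMap.lTensor_tmul]
      congr 1
      exact projGE_of_mem ⁅x, y⁆

lemma cocycle_lie (D E : Sbar) :
    cocycle ⁅D, E⁆ = extAct SbarGE SbarGE (cocycle D) (cocycle E) +
      LinearMap.rTensor SbarGE D.1.toLinearMap (cocycle E) -
      LinearMap.rTensor SbarGE E.1.toLinearMap (cocycle D) := by
  have hcomm : ∀ (D E : Sbar), LinearMap.lTensor A2 projGE
      (LinearMap.rTensor Sbar D.1.toLinearMap (taylor 1 E)) =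
      LinearMap.rTensor SbarGE D.1.toLinearMap (cocycle E) := by
    intro D E
    rw [cocycle_apply, ← LinearMap.comp_apply, ← LinearMap.comp_apply,
      LinearMap.lTensor_comp_rTensor, LinearMap.rTensor_comp_lTensor]
  rw [← hcomm, ← hcomm, ← projGE_extAct, ← map_add, ← map_sub, cocycle_apply, taylor_lie]
  congr 1
  have hD : LinearMap.lTensor A2 SbarGE.toSubmodule.subtype (cocycle D)
      = taylor 1 D - constPart D := by rw [taylor_decomp D]; abel
  have hE : LinearMap.lTensor A2 SbarGE.toSubmodule.subtype (cocycle E)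
      = taylor 1 E - constPart E := by rw [taylor_decomp E]; abel
  rw [hD, hE]
  simp only [map_sub, LinearMap.sub_apply, extAct_constPart_constPart, extAct_constPart_taylor]
  rw [extAct_skew (taylor 1 D) (constPart E), extAct_constPart_taylor]
  abel

/-- The operator by which the generator `∂_i` of the Weyl algebra `𝒟₂` acts on `A₂^a`, the twist of
`A₂` by `σ_a : t_i ↦ t_i, ∂_i ↦ ∂_i + a_i`; the generators `t_i` act by multiplication. -/
noncomputable def twistedPartial (a : Fin 2 → ℂ) (i : Fin 2) : A2 →ₗ[ℂ] A2 :=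
  (pderiv i : W2).toLinearMap + a i • LinearMap.id

/-- The operator by which `D = ∑ i, p_i ∂_i`, viewed in `𝒟₂`, acts on `A₂^a`. -/
noncomputable def twistedField (a : Fin 2 → ℂ) (D : W2) : A2 →ₗ[ℂ] A2 :=
  ∑ i, LinearMap.mulLeft ℂ (D (X i)) ∘ₗ twistedPartial a i

lemma twistedField_apply (a : Fin 2 → ℂ) (D : W2) (p : A2) :
    twistedField a D p = D p + (∑ i, a i • D (X i)) * p := by
  rw [W2_apply D p]
  simp [twistedField, twistedPartial, Fin.sum_univ_two, smul_eq_C_mul]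
  ring

lemma twistedField_lie (a : Fin 2 → ℂ) (D E : W2) (p : A2) :
    twistedField a ⁅D, E⁆ p =
      twistedField a D (twistedField a E p) - twistedField a E (twistedField a D p) := by
  simp only [twistedField_apply, Derivation.commutator_apply, Fin.sum_univ_two, map_add,
    Derivation.leibniz, smul_eq_mul, smul_eq_C_mul, derivation_C]
  ring

lemma rTensor_twistedField_extAct (a : Fin 2 → ℂ) {V L : Type*} [AddCommGroup V] [Module ℂ V] [LieRing L] [LieAlgebra ℂ L]
    [LieRingModule L V] [LieModule ℂ L V] (D : W2) (z : A2 ⊗[ℂ] L) (u : A2 ⊗[ℂ] V) :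
    LinearMap.rTensor V (twistedField a D) (extAct L V z u) =
      extAct L V (LinearMap.rTensor L D.toLinearMap z) u +
      extAct L V z (LinearMap.rTensor V (twistedField a D) u) := by
  induction z with
  | zero => simp
  | add a b ha hb => simp only [map_add, LinearMap.add_apply, ha, hb]; abel
  | tmul f x =>
    induction u with
    | zero => simp
    | add a b ha hb => simp only [map_add, ha, hb]; abel
    | tmul g y =>
      simp only [extAct_tmul, LinearMap.rTensor_tmul, Derivation.coeFn_coe, twistedField_apply,
        ← TensorProduct.add_tmul, Derivation.leibniz, smul_eq_mul]
      congr 1; ring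

section tensor
variable (a : Fin 2 → ℂ) (V : Type*) [AddCommGroup V] [Module ℂ V]
    [LieRingModule SbarGE V] [LieModule ℂ SbarGE V]

/-- The action of `D ∈ S̄₂` on `T(A₂^a, V) = A₂^a ⊗ V`:
`D (p ⊗ v) = (D p) ⊗ v + ∑_r (t^r / r!) p ⊗ (∂^r D)_{≥0} v`. -/
noncomputable def tensorAct (D : Sbar) : A2 ⊗[ℂ] V →ₗ[ℂ] A2 ⊗[ℂ] V :=
  LinearMap.rTensor V (twistedField a D.1) + extAct SbarGE V (cocycle D)

variable {V}

lemma tensorAct_lie (D E : Sbar) (w : A2 ⊗[ℂ] V) :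
    tensorAct a V ⁅D, E⁆ w =
      tensorAct a V D (tensorAct a V E w) - tensorAct a V E (tensorAct a V D w) := by
  have h : LinearMap.rTensor V (twistedField a ⁅D.1, E.1⁆) w =
      LinearMap.rTensor V (twistedField a D.1) (LinearMap.rTensor V (twistedField a E.1) w) -
      LinearMap.rTensor V (twistedField a E.1) (LinearMap.rTensor V (twistedField a D.1) w) := by
    induction w with
    | zero => simp
    | add a b ha hb => simp only [map_add, ha, hb]; abel
    | tmul g y =>
      simp only [LinearMap.rTensor_tmul, twistedField_lie, TensorProduct.sub_tmul]
  simp only [tensorAct, LinearMap.add_apply, map_add, rTensor_twistedField_extAct, cocycle_lie,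
    map_sub, LinearMap.sub_apply]
  change LinearMap.rTensor V (twistedField a ⁅D.1, E.1⁆) w + _ = _
  rw [h, extAct_leibniz (cocycle D) (cocycle E)]
  abel

lemma tensorAct_add (D E : Sbar) : tensorAct a V (D + E) = tensorAct a V D + tensorAct a V E := by
  ext p v
  simp [tensorAct, twistedField_apply, Finset.sum_add_distrib, add_mul, TensorProduct.add_tmul]
  abel

lemma tensorAct_smul (c : ℂ) (D : Sbar) : tensorAct a V (c • D) = c • tensorAct a V D := by
  ext p v
  have h : ∀ q : A2, twistedField a (c • D.1) q = c • twistedField a D.1 q := by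
    intro q
    simp only [twistedField_apply, Fin.sum_univ_two, Derivation.smul_apply, smul_eq_C_mul]
    ring
  have hc : (c • D : Sbar).1 = c • D.1 := rfl
  simp only [tensorAct, hc, map_smul, TensorProduct.AlgebraTensorModule.curry_apply,
    LinearMap.restrictScalars_self, LinearMap.comp_apply, TensorProduct.curry_apply,
    LinearMap.add_apply, LinearMap.smul_apply, LinearMap.rTensor_tmul, h, smul_add,
    TensorProduct.smul_tmul']

lemma tensorAct_smul_A2 (D : Sbar) (f : A2) (w : A2 ⊗[ℂ] V) :
    tensorAct a V D (f • w) = D.1 f • w + f • tensorAct a V D w := by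
  have h1 : ∀ z : A2 ⊗[ℂ] SbarGE, extAct SbarGE V z (f • w) = f • extAct SbarGE V z w := by
    intro z
    induction z with
    | zero => simp
    | add a b ha hb => simp only [map_add, LinearMap.add_apply, smul_add, ha, hb]
    | tmul g y =>
      induction w with
      | zero => simp
      | add a b ha hb => simp only [smul_add, map_add, ha, hb]
      | tmul p v => simp [extAct_tmul, TensorProduct.smul_tmul', mul_left_comm]
  have h2 : LinearMap.rTensor V (twistedField a D.1) (f • w) =
      D.1 f • w + f • LinearMap.rTensor V (twistedField a D.1) w := by
    clear h1
    induction w with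
    | zero => simp
    | add a b ha hb => simp only [smul_add, map_add, ha, hb]; abel
    | tmul p v =>
      simp only [TensorProduct.smul_tmul', LinearMap.rTensor_tmul, twistedField_apply,
        ← TensorProduct.add_tmul, Derivation.leibniz, smul_eq_mul]
      congr 1; ring
  simp only [tensorAct, LinearMap.add_apply, h1, h2, smul_add]
  abel

end tensor

/-- `A₂` as an abelian Lie algebra. -/
noncomputable instance (priority := 10) instLieRingA2 : LieRing A2 where
  bracket _ _ := 0
  add_lie _ _ _ := by simp
  lie_add _ _ _ := by simp
  lie_self _ := rfl
  leibniz_lie _ _ _ := by simp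

noncomputable instance (priority := 10) instLieAlgebraA2 : LieAlgebra ℂ A2 where
  lie_smul c _ _ := (smul_zero (A := A2) c).symm

lemma lie_A2 (f g : A2) : ⁅f, g⁆ = 0 := rfl

/-- `S̄₂` acts on `A₂` by derivations. -/
noncomputable def derivAction : Sbar →ₗ⁅ℂ⁆ LieDerivation ℂ A2 A2 where
  toFun D :=
    { toLinearMap := D.1.toLinearMap
      leibniz' := fun _ _ => by
        simp only [lie_A2, sub_self]; exact map_zero D.1 }
  map_add' _ _ := rfl
  map_smul' _ _ := rfl
  map_lie' := rfl

/-- The semidirect product `S̃₂ = S̄₂ ⋉ A₂`. -/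
abbrev Stilde : Type := LieAlgebra.SemiDirectSum A2 Sbar derivAction

/-- The inclusion of `A₂` in `S̃₂`. -/
noncomputable def inA : A2 →ₗ⁅ℂ⁆ Stilde := LieAlgebra.SemiDirectSum.inl derivAction
/-- The inclusion of `S̄₂` in `S̃₂`. -/
noncomputable def inS : Sbar →ₗ⁅ℂ⁆ Stilde := LieAlgebra.SemiDirectSum.inr derivAction

lemma inS_lie_inA (D : Sbar) (f : A2) : ⁅inS D, inA f⁆ = inA (D.1 f) := by
  refine LieAlgebra.SemiDirectSum.ext ?_ ?_
  · change (0 : A2) + D.1 f - derivAction 0 0 = D.1 f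
    simp
  · change ⁅D, (0 : Sbar)⁆ = 0
    simp

/-- Modules over a complex Lie algebra `L`; the morphisms are the `L`-module homomorphisms. -/
structure LieModCat (L : Type w) [LieRing L] [LieAlgebra ℂ L] where
  carrier : Type u
  [addCommGroup : AddCommGroup carrier]
  [module : Module ℂ carrier]
  [lieRingModule : LieRingModule L carrier]
  [lieModule : LieModule ℂ L carrier]

attribute [instance] LieModCat.addCommGroup LieModCat.module LieModCat.lieRingModule
  LieModCat.lieModule

instance (L : Type w) [LieRing L] [LieAlgebra ℂ L] : CoeSort (LieModCat.{w, u} L) (Type u) :=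
  ⟨LieModCat.carrier⟩

instance (L : Type w) [LieRing L] [LieAlgebra ℂ L] :
    Category (LieModCat.{w, u} L) where
  Hom M N := M →ₗ⁅ℂ, L⁆ N
  id _ := LieModuleHom.id
  comp f g := g.comp f

/-- The abelian subalgebra `Δ₂ = span {∂₁, ∂₂}` of `S̄₂`. -/
noncomputable def Delta : LieSubalgebra ℂ Sbar where
  toSubmodule := Submodule.span ℂ (Set.range partialS)
  lie_mem' := by
    intro x y hx hy
    change x ∈ Submodule.span ℂ (Set.range partialS) at hx
    change y ∈ Submodule.span ℂ (Set.range partialS) at hy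
    have : ⁅x, y⁆ = 0 := by
      induction hx, hy using Submodule.span_induction₂ with
      | mem_mem x y hx hy =>
        obtain ⟨i, rfl⟩ := hx
        obtain ⟨j, rfl⟩ := hy
        exact adPartial_partial i j
      | zero_left => simp
      | zero_right => simp
      | add_left x y z _ _ _ h1 h2 => rw [add_lie, h1, h2, add_zero]
      | add_right x y z _ _ _ h1 h2 => rw [lie_add, h1, h2, add_zero]
      | smul_left c x y _ _ h => rw [smul_lie, h, smul_zero]
      | smul_right c x y _ _ h => rw [lie_smul, h, smul_zero]
    change ⁅x, y⁆ ∈ Submodule.span ℂ (Set.range partialS)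
    rw [this]; exact zero_mem _

/-- The character `φ_a` of `Δ₂`, `φ_a(∂_i) = a_i`. (`Δ₂` is abelian, so every linear functional is a
Lie algebra homomorphism.) -/
noncomputable def phi (a : Fin 2 → ℂ) : Delta →ₗ[ℂ] ℂ :=
  (∑ i, a i • atOrigin i) ∘ₗ Delta.toSubmodule.subtype

lemma partialS_mem (i : Fin 2) : partialS i ∈ Delta := Submodule.subset_span ⟨i, rfl⟩

lemma phi_partialS (a : Fin 2 → ℂ) (i : Fin 2) : phi a ⟨partialS i, partialS_mem i⟩ = a i := by
  have h : ∀ j, atOrigin j (partialS i) = if i = j then 1 else 0 := by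
    intro j
    rw [atOrigin_apply]
    change coeff 0 (pderiv i (X j)) = _
    rw [pderiv_X, Pi.single_apply]
    split_ifs with h1 h2 h2
    · simp
    · exact absurd h1.symm h2
    · exact absurd h2.symm h1
    · simp
  change (∑ j, a j • atOrigin j) (partialS i) = a i
  simp only [LinearMap.sum_apply, LinearMap.smul_apply, h, smul_eq_mul, mul_ite, mul_one, mul_zero,
    Finset.sum_ite_eq, Finset.mem_univ, if_true]

section tensorModule
variable (a : Fin 2 → ℂ) (V : Type u) [AddCommGroup V] [Module ℂ V]
    [LieRingModule SbarGE V] [LieModule ℂ SbarGE V]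

/-- The `S̃₂`-module structure of `T(A₂^a, V)`: `A₂` acts by multiplication on the factor `A₂^a`, and
`S̄₂` by `tensorAct`. -/
@[reducible]
noncomputable def tensorLieRingModule : LieRingModule Stilde (A2 ⊗[ℂ] V) where
  bracket s w := s.left • w + tensorAct a V s.right w
  add_lie s t w := by
    change (s.left + t.left) • w + tensorAct a V (s.right + t.right) w = _
    rw [add_smul, tensorAct_add, LinearMap.add_apply]; abel
  lie_add s w w' := by
    rw [smul_add, map_add]; abel
  leibniz_lie s t w := by
    change _ = (((0 : A2) + s.right.1 t.left - t.right.1 s.left) • w +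
      tensorAct a V ⁅s.right, t.right⁆ w) + _
    simp only [map_add, smul_add, tensorAct_smul_A2, tensorAct_lie, zero_add]
    have hs : (s.right.1 t.left - t.right.1 s.left) • w
        = s.right.1 t.left • w - t.right.1 s.left • w :=
      sub_smul (R := A2) (M := A2 ⊗[ℂ] V) _ _ _
    rw [hs, smul_smul, smul_smul, mul_comm]
    abel

lemma tensorLieModule :
    letI := tensorLieRingModule a V
    LieModule ℂ Stilde (A2 ⊗[ℂ] V) :=
  letI := tensorLieRingModule a V
  { smul_lie := fun c s w => by
      change (c • s.left) • w + tensorAct a V (c • s.right) w =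
        c • (s.left • w + tensorAct a V s.right w)
      rw [tensorAct_smul, smul_assoc, smul_add, LinearMap.smul_apply]
    lie_smul := fun c s w => by
      change s.left • (c • w) + tensorAct a V s.right (c • w) =
        c • (s.left • w + tensorAct a V s.right w)
      rw [map_smul, smul_add, smul_comm] }

end tensorModule

/-- The `S̃₂`-module `T(A₂^a, V)`. -/
noncomputable def tensorObj (a : Fin 2 → ℂ) (V : LieModCat.{0, u} SbarGE) :
    LieModCat.{0, u} Stilde :=
  letI := tensorLieRingModule a V
  haveI := tensorLieModule a V
  { carrier := A2 ⊗[ℂ] V }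

lemma lTensor_tensorAct (a : Fin 2 → ℂ) {V W : LieModCat.{0, u} SbarGE} (f : V →ₗ⁅ℂ, SbarGE⁆ W)
    (D : Sbar) (w : A2 ⊗[ℂ] V) :
    LinearMap.lTensor A2 (f : V →ₗ[ℂ] W) (tensorAct a V D w) =
      tensorAct a W D (LinearMap.lTensor A2 (f : V →ₗ[ℂ] W) w) := by
  have h : ∀ z : A2 ⊗[ℂ] SbarGE, LinearMap.lTensor A2 (f : V →ₗ[ℂ] W) (extAct SbarGE V z w) =
      extAct SbarGE W z (LinearMap.lTensor A2 (f : V →ₗ[ℂ] W) w) := by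
    intro z
    induction z with
    | zero => simp
    | add a b ha hb => simp only [map_add, LinearMap.add_apply, ha, hb]
    | tmul g y =>
      induction w with
      | zero => simp
      | add a b ha hb => simp only [map_add, ha, hb]
      | tmul p v => simp [extAct_tmul]
  simp only [tensorAct, LinearMap.add_apply, map_add, h]
  congr 1
  rw [← LinearMap.comp_apply, ← LinearMap.comp_apply, LinearMap.lTensor_comp_rTensor,
    LinearMap.rTensor_comp_lTensor]

/-- `T(A₂^a, f) = id ⊗ f`. -/
noncomputable def tensorMap (a : Fin 2 → ℂ) {V W : LieModCat.{0, u} SbarGE}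
    (f : V →ₗ⁅ℂ, SbarGE⁆ W) : tensorObj a V →ₗ⁅ℂ, Stilde⁆ tensorObj a W where
  toLinearMap := LinearMap.lTensor A2 (f : V →ₗ[ℂ] W)
  map_lie' := by
    intro s (w : A2 ⊗[ℂ] V)
    change LinearMap.lTensor A2 (f : V →ₗ[ℂ] W) (s.left • w + tensorAct a V s.right w) =
      s.left • (LinearMap.lTensor A2 (f : V →ₗ[ℂ] W) w : A2 ⊗[ℂ] W) +
        tensorAct a W s.right (LinearMap.lTensor A2 (f : V →ₗ[ℂ] W) w)
    rw [map_add, lTensor_tensorAct]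
    congr 1
    exact (LinearMap.baseChange A2 (f : V →ₗ[ℂ] W)).map_smul s.left w

/-- The functor `V ↦ T(A₂^a, V)`. -/
noncomputable def tensorFunctor (a : Fin 2 → ℂ) :
    LieModCat.{0, u} SbarGE ⥤ LieModCat.{0, u} Stilde where
  obj V := tensorObj a V
  map f := tensorMap a f
  map_id V := LieModuleHom.ext fun w => LinearMap.congr_fun (LinearMap.lTensor_id A2 V) w
  map_comp f g := LieModuleHom.ext fun w =>
    LinearMap.congr_fun (LinearMap.lTensor_comp A2 (g : _ →ₗ⁅ℂ, SbarGE⁆ _).toLinearMap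
      (f : _ →ₗ⁅ℂ, SbarGE⁆ _).toLinearMap) w

lemma inS_inA {M : Type u} [AddCommGroup M] [LieRingModule Stilde M] (D : Sbar) (f : A2) (m : M) :
    ⁅inS D, ⁅inA f, m⁆⁆ = ⁅inA (D.1 f), m⁆ + ⁅inA f, ⁅inS D, m⁆⁆ := by
  rw [leibniz_lie, inS_lie_inA]

section whittaker
variable (M : Type u) [AddCommGroup M] [Module ℂ M] [LieRingModule Stilde M] [LieModule ℂ Stilde M]

/-- An `(A₂, S̄₂)`-module is an `S̃₂`-module on which `A₂` acts associatively. -/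
structure IsASModule : Prop where
  mul_act : ∀ (f g : A2) (m : M), ⁅inA f, ⁅inA g, m⁆⁆ = ⁅inA (f * g), m⁆
  one_act : ∀ m : M, ⁅inA 1, m⁆ = m

/-- A Whittaker module: `Δ₂` acts locally finitely, i.e. every vector lies in a finite-dimensional
`Δ₂`-stable subspace. -/
def IsWhittakerModule : Prop :=
  ∀ m : M, ∃ N : Submodule ℂ M, FiniteDimensional ℂ N ∧ m ∈ N ∧
    ∀ x : Delta, ∀ n ∈ N, ⁅inS x, n⁆ ∈ N

/-- `M = M(a)`: for all `m ∈ M` and `x ∈ Δ₂` some power of `x - φ_a(x)` kills `m`. -/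
def IsOfType (a : Fin 2 → ℂ) : Prop :=
  ∀ m : M, ∀ x : Delta, ∃ k : ℕ,
    ((LieModule.toEnd ℂ Stilde M (inS x) - phi a x • (1 : Module.End ℂ M)) ^ k) m = 0

/-- The space `Wh_a(M)` of Whittaker vectors. -/
def Wh (a : Fin 2 → ℂ) : Submodule ℂ M where
  carrier := {m | ∀ x : Delta, ⁅inS x, m⁆ = phi a x • m}
  zero_mem' := by intro x; simp
  add_mem' := by
    intro m n hm hn x
    rw [lie_add, hm x, hn x, smul_add]
  smul_mem' := by
    intro c m hm x
    rw [lie_smul, hm x, smul_comm]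

/-- `f ⊗ D ∈ A₂ ⊗ S̄₂` acts on an `S̃₂`-module by `m ↦ f (D m)`. -/
noncomputable def smashAct : A2 ⊗[ℂ] Sbar →ₗ[ℂ] Module.End ℂ M :=
  TensorProduct.lift ((LinearMap.mul ℂ (Module.End ℂ M)).compl₁₂
    ((LieModule.toEnd ℂ Stilde M : Stilde →ₗ[ℂ] Module.End ℂ M) ∘ₗ (inA : A2 →ₗ[ℂ] Stilde))
    ((LieModule.toEnd ℂ Stilde M : Stilde →ₗ[ℂ] Module.End ℂ M) ∘ₗ (inS : Sbar →ₗ[ℂ] Stilde)))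

/-- The operator `∑_r (-1)^{|r|} (t^r / r!) ∘ ∂^r D`. For `D ∈ S̄₂^{≥0}` this is the action of the
preimage of `1 ⊗ D` under the isomorphism `A₂ # U(S̄₂) ≅ 𝒟₂ ⊗ U(S̄₂^{≥0})`. -/
noncomputable def whAct (D : Sbar) : Module.End ℂ M := smashAct M (taylor (-1) D)

variable {M}

lemma smashAct_tmul (f : A2) (D : Sbar) (m : M) :
    smashAct M (f ⊗ₜ D) m = ⁅inA f, ⁅inS D, m⁆⁆ := rfl

lemma inS_smashAct (Z : Sbar) (z : A2 ⊗[ℂ] Sbar) (m : M) :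
    ⁅inS Z, smashAct M z m⁆ = smashAct M (LinearMap.rTensor Sbar Z.1.toLinearMap z) m +
      smashAct M (extAct Sbar Sbar (1 ⊗ₜ Z) z) m + smashAct M z ⁅inS Z, m⁆ := by
  induction z with
  | zero => simp
  | add a b ha hb => simp only [map_add, LinearMap.add_apply, lie_add, ha, hb]; abel
  | tmul f D =>
    simp only [extAct_tmul, LinearMap.rTensor_tmul, smashAct_tmul, one_mul, Derivation.coeFn_coe]
    rw [inS_inA, leibniz_lie (inS Z) (inS D), ← LieHom.map_lie, lie_add, add_assoc]

lemma whAct_commute_partial (D : Sbar) (i : Fin 2) (m : M) :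
    ⁅inS (partialS i), whAct M D m⁆ = whAct M D ⁅inS (partialS i), m⁆ := by
  rw [whAct, inS_smashAct, extAct_tmul_partial, one_smul]
  change smashAct M (LinearMap.rTensor Sbar (pderiv i : W2).toLinearMap (taylor (-1) D)) m + _ + _
    = _
  rw [pderiv_taylor]
  simp

lemma whAct_commute_Delta (D : Sbar) (x : Sbar) (hx : x ∈ Delta) (m : M) :
    ⁅inS x, whAct M D m⁆ = whAct M D ⁅inS x, m⁆ := by
  change x ∈ Submodule.span ℂ (Set.range partialS) at hx
  induction hx using Submodule.span_induction with
  | mem x hx => obtain ⟨i, rfl⟩ := hx; exact whAct_commute_partial D i m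
  | zero => rw [map_zero, zero_lie, zero_lie, map_zero]
  | add x y _ _ h1 h2 => simp only [map_add, add_lie, h1, h2]
  | smul c x _ h => simp only [map_smul, smul_lie, h]

lemma whAct_mem (a : Fin 2 → ℂ) (D : Sbar) {m : M} (hm : m ∈ Wh M a) : whAct M D m ∈ Wh M a := by
  intro x
  rw [whAct_commute_Delta D x x.2, hm x, map_smul]

/-- `f ⊗ D ↦ f p_j` for `D = ∑ j, p_j ∂_j`. -/
noncomputable def evalComp (j : Fin 2) : A2 ⊗[ℂ] Sbar →ₗ[ℂ] A2 :=
  TensorProduct.lift ((LinearMap.mul ℂ A2).compl₂ (component j))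

lemma evalComp_tmul (j : Fin 2) (f : A2) (D : Sbar) : evalComp j (f ⊗ₜ D) = f * D.1 (X j) := rfl

lemma evalComp_taylor (j : Fin 2) {D : Sbar} (hD : D ∈ SbarGE) :
    evalComp j (taylor (-1) D) = 0 := by
  have h1 : ∀ (i : Fin 2) (z : A2 ⊗[ℂ] Sbar), pderiv i (evalComp j z) =
      evalComp j (LinearMap.rTensor Sbar (pderiv i : W2).toLinearMap z) +
      evalComp j (LinearMap.lTensor A2 (adPartial i) z) := by
    intro i z
    induction z with
    | zero => simp
    | add a b ha hb => simp only [map_add, ha, hb]; abel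
    | tmul f E =>
      simp only [LinearMap.rTensor_tmul, LinearMap.lTensor_tmul, evalComp_tmul, pderiv_mul]
      have := component_adPartial i j E
      simp only [component, LinearMap.coe_mk, AddHom.coe_mk] at this
      rw [this]; rfl
  have h2 : ∀ z : A2 ⊗[ℂ] Sbar, coeff 0 (evalComp j z) = atOrigin j (tcoeff 0 z) := by
    intro z
    induction z with
    | zero => simp
    | add a b ha hb => simp only [map_add, coeff_add, ha, hb]
    | tmul f E =>
      simp only [evalComp_tmul, tcoeff_tmul, map_smul, atOrigin_apply, ← constantCoeff_eq, map_mul,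
        smul_eq_mul]
  have h3 : ∀ i, pderiv i (evalComp j (taylor (-1) D)) = 0 := by
    intro i
    rw [h1, pderiv_taylor]; simp
  ext r
  rw [coeff_zero]
  induction r using multi_induction with
  | h0 => rw [h2, tcoeff_zero_taylor, atOrigin_of_mem hD]
  | hs r i _ =>
    have := congrArg (coeff r) (h3 i)
    rw [coeff_pderiv, coeff_zero] at this
    exact (mul_eq_zero.mp this).resolve_right (Nat.cast_add_one_ne_zero _)

lemma whAct_commute_A2 (hM : IsASModule M) {D : Sbar} (hD : D ∈ SbarGE) (g : A2) (m : M) :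
    whAct M D ⁅inA g, m⁆ = ⁅inA g, whAct M D m⁆ := by
  have h : ∀ z : A2 ⊗[ℂ] Sbar, smashAct M z ⁅inA g, m⁆ =
      ⁅inA (∑ i, evalComp i z * pderiv i g), m⁆ + ⁅inA g, smashAct M z m⁆ := by
    intro z
    induction z with
    | zero =>
      simp only [map_zero, zero_mul, Finset.sum_const_zero, LinearMap.zero_apply, lie_zero,
        zero_lie, add_zero]
    | add a b ha hb =>
      simp only [map_add, LinearMap.add_apply, lie_add, ha, hb, add_mul, Finset.sum_add_distrib,
        add_lie]
      abel
    | tmul f E =>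
      simp only [smashAct_tmul, evalComp_tmul, mul_assoc, ← Finset.mul_sum, ← W2_apply]
      rw [inS_inA, lie_add, hM.mul_act, hM.mul_act, hM.mul_act, mul_comm g f]
  rw [whAct, h]
  simp only [evalComp_taylor _ hD, zero_mul, Finset.sum_const_zero, map_zero, zero_lie, zero_add]

lemma inA_smashAct (hM : IsASModule M) (g : A2) (z : A2 ⊗[ℂ] Sbar) (m : M) :
    ⁅inA g, smashAct M z m⁆ = smashAct M (g • z) m := by
  induction z with
  | zero => simp
  | add a b ha hb => simp only [map_add, LinearMap.add_apply, lie_add, ha, hb, smul_add]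
  | tmul f E => rw [TensorProduct.smul_tmul', smashAct_tmul, smashAct_tmul, hM.mul_act, smul_eq_mul]

lemma whAct_lie (hM : IsASModule M) {D E : Sbar} (hD : D ∈ SbarGE) (hE : E ∈ SbarGE) (m : M) :
    whAct M ⁅D, E⁆ m = whAct M D (whAct M E m) - whAct M E (whAct M D m) := by
  have h : ∀ w : A2 ⊗[ℂ] Sbar, whAct M D (smashAct M w m) =
      smashAct M w (whAct M D m) -
      smashAct M (∑ i, evalComp i w •
        LinearMap.rTensor Sbar (pderiv i : W2).toLinearMap (taylor (-1) D)) m -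
      smashAct M (extAct Sbar Sbar w (taylor (-1) D)) m := by
    intro w
    induction w with
    | zero => simp
    | add a b ha hb =>
      simp only [map_add, LinearMap.add_apply, ha, hb, add_smul, Finset.sum_add_distrib]
      abel
    | tmul g Z =>
      rw [smashAct_tmul, whAct_commute_A2 hM hD, smashAct_tmul]
      have h1 := inS_smashAct Z (taylor (-1) D) m
      have h2 : extAct Sbar Sbar (g ⊗ₜ Z) (taylor (-1) D)
          = g • extAct Sbar Sbar (1 ⊗ₜ Z) (taylor (-1) D) := by
        induction taylor (-1) D with
        | zero => simp
        | add a b ha hb => simp only [map_add, smul_add, ha, hb]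
        | tmul p v => simp [extAct_tmul, TensorProduct.smul_tmul']
      have h3 : (∑ i, evalComp i (g ⊗ₜ Z) •
          LinearMap.rTensor Sbar (pderiv i : W2).toLinearMap (taylor (-1) D))
          = g • LinearMap.rTensor Sbar Z.1.toLinearMap (taylor (-1) D) := by
        rw [rTensor_eq_sum Z.1, Finset.smul_sum]
        simp only [evalComp_tmul, mul_smul]
      rw [h2, h3, ← inA_smashAct hM, ← inA_smashAct hM]
      change ⁅inA g, smashAct M (taylor (-1) D) ⁅inS Z, m⁆⁆ =
        ⁅inA g, ⁅inS Z, smashAct M (taylor (-1) D) m⁆⁆ - _ - _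
      rw [h1, lie_add, lie_add]
      abel
  have h' := h (taylor (-1) E)
  rw [extAct_skew, ← taylor_lie] at h'
  simp only [evalComp_taylor _ hE, zero_smul, Finset.sum_const_zero, map_zero,
    LinearMap.zero_apply, sub_zero, map_neg, LinearMap.neg_apply, sub_neg_eq_add] at h'
  change whAct M D (whAct M E m) = whAct M E (whAct M D m) + whAct M ⁅D, E⁆ m at h'
  rw [h']; abel

lemma whAct_add (D E : Sbar) (m : M) : whAct M (D + E) m = whAct M D m + whAct M E m := by
  change smashAct M (taylorₗ (-1) (D + E)) m = _
  rw [map_add, map_add]; rfl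

lemma whAct_smul (c : ℂ) (D : Sbar) (m : M) : whAct M (c • D) m = c • whAct M D m := by
  change smashAct M (taylorₗ (-1) (c • D)) m = _
  rw [map_smul, map_smul]; rfl

variable (M) in
/-- The `S̄₂^{≥0}`-module structure of `Wh_a(M)`, given by `whAct`. -/
@[reducible]
noncomputable def whLieRingModule (a : Fin 2 → ℂ) (hM : IsASModule M) :
    LieRingModule SbarGE (Wh M a) where
  bracket x m := ⟨whAct M x m, whAct_mem a x m.2⟩
  add_lie x y m := Subtype.ext (whAct_add x.1 y.1 m.1)
  lie_add x m n := Subtype.ext (map_add (whAct M x.1) m.1 n.1)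
  leibniz_lie x y m := Subtype.ext (by
    have h := whAct_lie hM x.2 y.2 m.1
    change whAct M x.1 (whAct M y.1 m.1) =
      whAct M ⁅x.1, y.1⁆ m.1 + whAct M y.1 (whAct M x.1 m.1)
    rw [h]; abel)

variable (M) in
lemma whLieModule (a : Fin 2 → ℂ) (hM : IsASModule M) :
    letI := whLieRingModule M a hM
    LieModule ℂ SbarGE (Wh M a) :=
  letI := whLieRingModule M a hM
  { smul_lie := fun c x m => Subtype.ext (whAct_smul c x.1 m.1)
    lie_smul := fun c x m => Subtype.ext (map_smul (whAct M x.1) c m.1) }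

end whittaker

/-- The conditions that define the block: Whittaker `(A₂, S̄₂)`-modules of type `φ_a` with
finite-dimensional space of Whittaker vectors. -/
structure IsOmega (a : Fin 2 → ℂ) (M : LieModCat.{0, u} Stilde) : Prop where
  isAS : IsASModule M
  isWhittaker : IsWhittakerModule M
  isOfType : IsOfType M a
  finite : FiniteDimensional ℂ (Wh M a)

/-- The conditions of `IsOmega` as a property of objects. -/
def isOmega (a : Fin 2 → ℂ) : ObjectProperty (LieModCat.{0, u} Stilde) := IsOmega a

/-- The category `Ω_a`, a full subcategory of the category of `S̃₂`-modules. -/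
abbrev Omega (a : Fin 2 → ℂ) := (isOmega.{u} a).FullSubcategory

/-- Finite-dimensional `S̄₂^{≥0}`-modules. -/
def isFiniteDimensional : ObjectProperty (LieModCat.{0, u} SbarGE) := fun V => FiniteDimensional ℂ V

/-- The category of finite-dimensional `S̄₂^{≥0}`-modules. -/
abbrev SbarGEFMod := isFiniteDimensional.{u}.FullSubcategory

/-- `Wh_a(M)` as an `S̄₂^{≥0}`-module. -/
noncomputable def whObj (a : Fin 2 → ℂ) (M : Omega.{u} a) : SbarGEFMod.{u} where
  obj :=
    letI := whLieRingModule M.obj a M.property.isAS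
    haveI := whLieModule M.obj a M.property.isAS
    { carrier := Wh M.obj a }
  property := M.property.finite

lemma map_smashAct {M N : LieModCat.{0, u} Stilde} (f : M →ₗ⁅ℂ, Stilde⁆ N) (z : A2 ⊗[ℂ] Sbar)
    (m : M) : f (smashAct M z m) = smashAct N z (f m) := by
  induction z with
  | zero => simp
  | add a b ha hb => simp only [map_add, LinearMap.add_apply, ha, hb]
  | tmul g Z => simp only [smashAct_tmul, LieModuleHom.map_lie]

/-- The restriction of a homomorphism `M → N` to Whittaker vectors. -/
noncomputable def whMap (a : Fin 2 → ℂ) {M N : Omega.{u} a} (f : M.obj →ₗ⁅ℂ, Stilde⁆ N.obj) :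
    (whObj a M).obj →ₗ⁅ℂ, SbarGE⁆ (whObj a N).obj where
  toLinearMap := LinearMap.restrict (p := Wh M.obj a) (q := Wh N.obj a) f.toLinearMap
    (fun m hm x => by
      change ⁅inS x.1, f m⁆ = phi a x • f m
      rw [← LieModuleHom.map_lie, hm x, map_smul])
  map_lie' {x m} := Subtype.ext (map_smashAct f _ m.1)

/-- The functor `M ↦ Wh_a(M)`. -/
noncomputable def whittakerFunctor (a : Fin 2 → ℂ) : Omega.{u} a ⥤ SbarGEFMod.{u} where
  obj M := whObj a M
  map f := ObjectProperty.homMk (whMap a f.hom)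
  map_id _ := rfl
  map_comp _ _ := rfl

end WhittakerS2

/-!
A vector of `A₂ ⊗ V` killed by every `∂_i` is of the form `1 ⊗ v`, so `v ↦ 1 ⊗ v` identifies `V`
with the Whittaker vectors of `T(A₂^a, V)`. Conversely, on an `(A₂, S̄₂)`-module `M` of type
`φ_a` the operators `∂_i - a_i` are locally nilpotent and form with the `t_i` a representation
of the Weyl algebra, so, as for Kashiwara's theorem at a point, every vector is a combination of
the `t^r m` with `m` a Whittaker vector, and uniquely so: multiplication `A₂ ⊗ Wh_a(M) → M` is
bijective. It is a map of `S̄₂`-modules because the two Taylor sums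
`D ↦ ∑_r (± t)^r / r! ⊗ ∂^r D` extend to mutually inverse `A₂`-linear maps of `A₂ ⊗ S̄₂`: a
vector field is thereby recovered from its constant part, which acts on Whittaker vectors through
`a`, and from the operators that define the action of `S̄₂^{≥0}` on `Wh_a(M)`.
-/

namespace WhittakerS2

open MvPolynomial TensorProduct CategoryTheory

section EndLemmas

variable {R N : Type*} [AddCommGroup N]

lemma exists_fg_le_comap_of_commute [CommRing R] [Module R N] {f g : Module.End R N}
    (hfg : Commute f g) {m : N} {n k : ℕ} (hf : (f ^ n) m = 0) (hg : (g ^ k) m = 0) :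
    ∃ P : Submodule R N, P.FG ∧ m ∈ P ∧ P ≤ P.comap f ∧ P ≤ P.comap g := by
  let v : ℕ × ℕ → N := fun p => (f ^ p.1 * g ^ p.2) m
  have hv : (Set.range v).Finite := by
    refine (((Finset.range n ×ˢ Finset.range k).finite_toSet.image v).insert 0).subset ?_
    rintro _ ⟨⟨p, q⟩, rfl⟩
    by_cases hp : p < n
    · by_cases hq : q < k
      · exact Or.inr ⟨(p, q), by simp [hp, hq], rfl⟩
      · refine Or.inl ?_
        change (f ^ p * g ^ q) m = 0
        rw [Module.End.mul_apply, Module.End.pow_map_zero_of_le (not_lt.1 hq) hg, map_zero]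
    · refine Or.inl ?_
      change (f ^ p * g ^ q) m = 0
      rw [(hfg.pow_pow p q).eq, Module.End.mul_apply,
        Module.End.pow_map_zero_of_le (not_lt.1 hp) hf, map_zero]
  refine ⟨Submodule.span R (Set.range v), Submodule.fg_span hv,
    Submodule.subset_span ⟨(0, 0), by simp [v]⟩, ?_, ?_⟩ <;>
    rw [Submodule.span_le] <;> rintro _ ⟨⟨p, q⟩, rfl⟩ <;> apply Submodule.subset_span
  · exact ⟨(p + 1, q), by simp only [v, pow_succ', Module.End.mul_apply]⟩
  · refine ⟨(p, q + 1), ?_⟩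
    change (f ^ p * g ^ (q + 1)) m = (g * (f ^ p * g ^ q)) m
    rw [pow_succ', ← mul_assoc, ← mul_assoc, (hfg.pow_left p).eq]

lemma pow_apply_pow_apply_of_commutator_eq_one [CommRing R] [Module R N] {θ τ : Module.End R N}
    (h : θ * τ = τ * θ + 1) {u : N} (hu : θ u = 0) (n : ℕ) :
    (θ ^ n) ((τ ^ n) u) = (n.factorial : R) • u := by
  have hθτ (m : N) : θ (τ m) = τ (θ m) + m := LinearMap.congr_fun h m
  have hstep (n : ℕ) : θ ((τ ^ (n + 1)) u) = ((n + 1 : ℕ) : R) • (τ ^ n) u := by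
    induction n with
    | zero => simp [hθτ, hu]
    | succ n ih =>
      rw [pow_succ' τ (n + 1), Module.End.mul_apply, hθτ, ih, map_smul, ← Module.End.mul_apply,
        ← pow_succ', Nat.cast_succ (n + 1), add_smul, one_smul]
  induction n with
  | zero => simp
  | succ n ih =>
    rw [pow_succ, Module.End.mul_apply, hstep, map_smul, ih, smul_smul, Nat.factorial_succ,
      Nat.cast_mul]

lemma le_of_ker_inf_le [Field R] [CharZero R] [Module R N] {θ τ : Module.End R N}
    (h : θ * τ = τ * θ + 1) (hnil : ∀ m, ∃ n, (θ ^ n) m = 0) {K S : Submodule R N}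
    (hKθ : ∀ m ∈ K, θ m ∈ K) (hKτ : ∀ m ∈ K, τ m ∈ K) (hSτ : ∀ m ∈ S, τ m ∈ S)
    (hKS : LinearMap.ker θ ⊓ K ≤ S) : K ≤ S := by
  intro m hm
  obtain ⟨n, hn⟩ := hnil m
  induction n generalizing m with
  | zero => exact (show m = 0 from hn) ▸ S.zero_mem
  | succ n ih =>
    set u := (θ ^ n) m with hu
    have huK : u ∈ K := Module.End.pow_apply_mem_of_forall_mem n hKθ m hm
    have hθu : θ u = 0 := by rwa [pow_succ', Module.End.mul_apply] at hn
    have hdiff : m - (n.factorial : R)⁻¹ • (τ ^ n) u ∈ S := by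
      have hτu : (τ ^ n) u ∈ K := Module.End.pow_apply_mem_of_forall_mem n hKτ u huK
      refine ih (K.sub_mem hm (K.smul_mem _ hτu)) ?_
      rw [map_sub, map_smul, pow_apply_pow_apply_of_commutator_eq_one h hθu,
        inv_smul_smul₀ (Nat.cast_ne_zero.2 n.factorial_ne_zero), ← hu, sub_self]
    have hlead : (n.factorial : R)⁻¹ • (τ ^ n) u ∈ S :=
      S.smul_mem _ (Module.End.pow_apply_mem_of_forall_mem n hSτ u (hKS ⟨hθu, huK⟩))
    simpa only [sub_add_cancel] using S.add_mem hdiff hlead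

end EndLemmas

section Coefficients

variable {V : Type*} [AddCommGroup V] [Module ℂ V]

lemma tcoeff_zero_smul (f : A2) (w : A2 ⊗[ℂ] V) :
    tcoeff 0 (f • w) = coeff 0 f • tcoeff 0 w := by
  induction w with
  | zero => simp
  | add w w' hw hw' => simp only [smul_add, map_add, hw, hw']
  | tmul g v =>
    simp only [TensorProduct.smul_tmul', tcoeff_tmul, smul_eq_mul, smul_smul, ← constantCoeff_eq,
      map_mul]

lemma tcoeff_zero_one_tmul (v : V) : tcoeff 0 ((1 : A2) ⊗ₜ[ℂ] v) = v := by
  rw [tcoeff_tmul, coeff_zero_one, one_smul]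

lemma tcoeff_zero_extAct {L : Type*} [LieRing L] [LieAlgebra ℂ L] [LieRingModule L V]
    [LieModule ℂ L V] (z : A2 ⊗[ℂ] L) (v : V) :
    tcoeff 0 (extAct L V z (1 ⊗ₜ v)) = ⁅tcoeff 0 z, v⁆ := by
  induction z with
  | zero => simp
  | add y z hy hz => simp only [map_add, LinearMap.add_apply, add_lie, hy, hz]
  | tmul f x => rw [extAct_tmul, tcoeff_tmul, tcoeff_tmul, mul_one, smul_lie]

lemma eq_one_tmul_of_pderiv_eq_zero {w : A2 ⊗[ℂ] V}
    (h : ∀ i, LinearMap.rTensor V (pderiv i : W2).toLinearMap w = 0) :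
    w = 1 ⊗ₜ[ℂ] tcoeff 0 w := by
  refine tcoeff_ext fun r => ?_
  induction r using multi_induction with
  | h0 => rw [tcoeff_zero_one_tmul]
  | hs r i _ =>
    have hw : tcoeff (r + Finsupp.single i 1) w = 0 := by
      have hi := congrArg (tcoeff r) (h i)
      rw [tcoeff_pderiv, map_zero] at hi
      exact (smul_eq_zero.mp hi).resolve_left (Nat.cast_add_one_ne_zero _)
    have hr : (0 : Fin 2 →₀ ℕ) ≠ r + Finsupp.single i 1 := fun h0 => by
      simpa using DFunLike.congr_fun h0 i
    rw [hw, tcoeff_tmul, coeff_one, if_neg hr, zero_smul]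

variable (V) in
/-- The elements of degree less than `n` of `A₂ ⊗ V = V[t₁, t₂]`; the operators `∂_i` lower the
degree, which gives the inductions on vectors of `A₂ ⊗ V`. -/
noncomputable def degreeLT (n : ℕ) : Submodule ℂ (A2 ⊗[ℂ] V) :=
  ⨅ r : {r : Fin 2 →₀ ℕ // n ≤ r.degree}, LinearMap.ker (tcoeff (L := V) r.1)

lemma mem_degreeLT {n : ℕ} {w : A2 ⊗[ℂ] V} :
    w ∈ degreeLT V n ↔ ∀ r : Fin 2 →₀ ℕ, n ≤ r.degree → tcoeff r w = 0 := by
  simp [degreeLT]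

lemma degreeLT_mono {m n : ℕ} (h : m ≤ n) : degreeLT V m ≤ degreeLT V n :=
  fun _ hw => mem_degreeLT.2 fun r hr => mem_degreeLT.1 hw r (h.trans hr)

lemma eq_zero_of_mem_degreeLT_zero {w : A2 ⊗[ℂ] V} (h : w ∈ degreeLT V 0) : w = 0 :=
  tcoeff_ext fun r => by rw [mem_degreeLT.1 h r (Nat.zero_le _), map_zero]

lemma exists_mem_degreeLT (w : A2 ⊗[ℂ] V) : ∃ n, w ∈ degreeLT V n := by
  induction w with
  | zero => exact ⟨0, zero_mem _⟩
  | add w w' hw hw' =>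
    obtain ⟨m, hm⟩ := hw
    obtain ⟨n, hn⟩ := hw'
    exact ⟨max m n, add_mem (degreeLT_mono (le_max_left _ _) hm)
      (degreeLT_mono (le_max_right _ _) hn)⟩
  | tmul f v =>
    refine ⟨f.totalDegree + 1, mem_degreeLT.2 fun r hr => ?_⟩
    rw [tcoeff_tmul, coeff_eq_zero_of_totalDegree_lt (Nat.lt_of_succ_le hr), zero_smul]

lemma pderiv_mem_degreeLT {n : ℕ} {w : A2 ⊗[ℂ] V} (h : w ∈ degreeLT V (n + 1)) (i : Fin 2) :
    LinearMap.rTensor V (pderiv i : W2).toLinearMap w ∈ degreeLT V n := by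
  refine mem_degreeLT.2 fun r hr => ?_
  rw [tcoeff_pderiv, mem_degreeLT.1 h, smul_zero]
  simpa only [map_add, Finsupp.degree_single, Nat.add_le_add_iff_right] using hr

lemma rTensor_derivation_smul {R A L : Type*} [CommRing R] [CommRing A] [Algebra R A]
    [AddCommGroup L] [Module R L] (D : Derivation R A A) (f : A) (z : A ⊗[R] L) :
    LinearMap.rTensor L D.toLinearMap (f • z) =
      D f • z + f • LinearMap.rTensor L D.toLinearMap z := by
  induction z with
  | zero => simp
  | add y z hy hz => simp only [smul_add, map_add, hy, hz]; abel
  | tmul g v =>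
    simp only [TensorProduct.smul_tmul', LinearMap.rTensor_tmul, Derivation.coeFn_coe,
      ← TensorProduct.add_tmul, Derivation.leibniz, smul_eq_mul]
    rw [add_comm, mul_comm g]

end Coefficients

section Delta

lemma atOrigin_partialS (i j : Fin 2) : atOrigin j (partialS i) = if i = j then 1 else 0 := by
  change coeff 0 (pderiv i (X j)) = _
  rw [pderiv_X, Pi.single_apply]
  simp only [eq_comm (a := j)]
  split_ifs <;> simp

lemma projGE_partialS (i : Fin 2) : projGE (partialS i) = 0 := by
  refine Subtype.ext ?_
  simp [projGE_coe, atOrigin_partialS]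

lemma Delta_eq_sum (x : Delta) : (x : Sbar) = ∑ i, atOrigin i x.1 • partialS i := by
  obtain ⟨x, hx⟩ := x
  change x ∈ Submodule.span ℂ (Set.range partialS) at hx
  have hle : Submodule.span ℂ (Set.range partialS) ≤ LinearMap.ker projGE :=
    Submodule.span_le.2 (Set.range_subset_iff.2 projGE_partialS)
  have hx0 := congrArg Subtype.val (LinearMap.mem_ker.1 (hle hx))
  exact sub_eq_zero.1 hx0

lemma phi_eq_sum (a : Fin 2 → ℂ) (x : Delta) : phi a x = ∑ i, atOrigin i x.1 * a i := by
  change (∑ i, a i • atOrigin i) x.1 = _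
  simp only [LinearMap.sum_apply, LinearMap.smul_apply, smul_eq_mul, mul_comm]

end Delta

section ShiftedPartial

variable {M : Type u} [AddCommGroup M] [Module ℂ M] [LieRingModule Stilde M] [LieModule ℂ Stilde M]
  {a : Fin 2 → ℂ}

variable (M a) in
/-- The operator `∂_i - a_i` on an `S̃₂`-module: the Whittaker vectors are the common kernel of
these two operators. -/
noncomputable def shiftedPartial (i : Fin 2) : Module.End ℂ M :=
  LieModule.toEnd ℂ Stilde M (inS (partialS i)) - a i • 1

lemma shiftedPartial_apply (i : Fin 2) (m : M) :
    shiftedPartial M a i m = ⁅inS (partialS i), m⁆ - a i • m := rfl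

lemma toEnd_Delta_sub (x : Delta) :
    LieModule.toEnd ℂ Stilde M (inS x.1) - phi a x • 1 =
      ∑ i, atOrigin i x.1 • shiftedPartial M a i := by
  conv_lhs => rw [Delta_eq_sum x, phi_eq_sum]
  simp only [shiftedPartial, map_sum, map_smul, Finset.sum_smul, smul_sub, mul_smul,
    Finset.sum_sub_distrib]

lemma Delta_lie_eq (x : Delta) (m : M) :
    ⁅inS x.1, m⁆ = ∑ i, atOrigin i x.1 • shiftedPartial M a i m + phi a x • m := by
  have h := LinearMap.congr_fun (toEnd_Delta_sub (M := M) (a := a) x) m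
  simp only [LinearMap.sum_apply, LinearMap.smul_apply] at h
  exact sub_eq_iff_eq_add.1 h

lemma mem_Wh_iff {m : M} : m ∈ Wh M a ↔ ∀ i, shiftedPartial M a i m = 0 := by
  constructor
  · intro h i
    rw [shiftedPartial_apply, sub_eq_zero, ← phi_partialS a i]
    exact h ⟨partialS i, partialS_mem i⟩
  · intro h x
    simp only [Delta_lie_eq (a := a), h, smul_zero, Finset.sum_const_zero, zero_add]

lemma lie_partialS_of_mem_Wh {m : M} (hm : m ∈ Wh M a) (i : Fin 2) :
    ⁅inS (partialS i), m⁆ = a i • m :=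
  sub_eq_zero.1 (mem_Wh_iff.1 hm i)

lemma commute_shiftedPartial (i j : Fin 2) :
    Commute (shiftedPartial M a i) (shiftedPartial M a j) := by
  have h : Commute (LieModule.toEnd ℂ Stilde M (inS (partialS i)))
      (LieModule.toEnd ℂ Stilde M (inS (partialS j))) := by
    have hij : ⁅partialS i, partialS j⁆ = 0 := adPartial_partial i j
    refine LinearMap.ext fun m => ?_
    change ⁅inS (partialS i), ⁅inS (partialS j), m⁆⁆ = ⁅inS (partialS j), ⁅inS (partialS i), m⁆⁆
    rw [leibniz_lie (inS (partialS i)), ← LieHom.map_lie, hij, map_zero, zero_lie, zero_add]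
  exact (h.sub_right ((Commute.one_right _).smul_right _)).sub_left
    (((Commute.one_left _).smul_left _).sub_right
      (((Commute.one_left _).smul_left _).smul_right _))

lemma shiftedPartial_inA (i : Fin 2) (f : A2) (m : M) :
    shiftedPartial M a i ⁅inA f, m⁆ = ⁅inA (pderiv i f), m⁆ + ⁅inA f, shiftedPartial M a i m⁆ := by
  rw [shiftedPartial_apply, shiftedPartial_apply, inS_inA, lie_sub, lie_smul, add_sub_assoc]
  rfl

lemma shiftedPartial_mul_X (hM : IsASModule M) (i : Fin 2) :
    shiftedPartial M a i * LieModule.toEnd ℂ Stilde M (inA (X i)) =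
      LieModule.toEnd ℂ Stilde M (inA (X i)) * shiftedPartial M a i + 1 := by
  refine LinearMap.ext fun m => ?_
  change shiftedPartial M a i ⁅inA (X i), m⁆ = ⁅inA (X i), shiftedPartial M a i m⁆ + m
  rw [shiftedPartial_inA, pderiv_X_self, hM.one_act, add_comm]

lemma IsOfType.exists_shiftedPartial_pow_eq_zero (hT : IsOfType M a) (i : Fin 2) (m : M) :
    ∃ k, (shiftedPartial M a i ^ k) m = 0 := by
  have h := hT m ⟨partialS i, partialS_mem i⟩
  rwa [phi_partialS] at h

lemma IsOfType.isWhittakerModule (hT : IsOfType M a) : IsWhittakerModule M := by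
  intro m
  obtain ⟨n, hn⟩ := hT.exists_shiftedPartial_pow_eq_zero 0 m
  obtain ⟨k, hk⟩ := hT.exists_shiftedPartial_pow_eq_zero 1 m
  obtain ⟨P, hPfg, hmP, hP0, hP1⟩ :=
    exists_fg_le_comap_of_commute (commute_shiftedPartial 0 1) hn hk
  refine ⟨P, Module.Finite.iff_fg.2 hPfg, hmP, fun x p hp => ?_⟩
  rw [Delta_lie_eq (a := a), Fin.sum_univ_two]
  exact P.add_mem (P.add_mem (P.smul_mem _ (hP0 hp)) (P.smul_mem _ (hP1 hp))) (P.smul_mem _ hp)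

lemma eq_top_of_Wh_le (hM : IsASModule M) (hT : IsOfType M a) {S : Submodule ℂ M}
    (hWh : Wh M a ≤ S) (hS : ∀ i, ∀ m ∈ S, ⁅inA (X i), m⁆ ∈ S) : S = ⊤ := by
  have hker : LinearMap.ker (shiftedPartial M a 0) ≤ S := by
    refine le_of_ker_inf_le (shiftedPartial_mul_X hM 1) (hT.exists_shiftedPartial_pow_eq_zero 1)
      (fun m hm => ?_) (fun m hm => ?_) (hS 1) fun m hm => hWh (mem_Wh_iff.2 fun i => ?_)
    · rw [LinearMap.mem_ker] at hm ⊢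
      rw [← Module.End.mul_apply, (commute_shiftedPartial 0 1).eq, Module.End.mul_apply, hm,
        map_zero]
    · rw [LinearMap.mem_ker] at hm ⊢
      rw [LieModule.toEnd_apply_apply, shiftedPartial_inA, hm, pderiv_X_of_ne (by decide),
        map_zero, zero_lie, lie_zero, add_zero]
    · fin_cases i
      exacts [hm.2, hm.1]
  exact top_le_iff.1 <| le_of_ker_inf_le (shiftedPartial_mul_X hM 0)
    (hT.exists_shiftedPartial_pow_eq_zero 0) (fun _ _ => trivial) (fun _ _ => trivial) (hS 0)
    (inf_le_left.trans hker)

end ShiftedPartial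

section Taylor

lemma lTensor_adPartial_taylor (c : ℂ) (i : Fin 2) (D : Sbar) :
    LinearMap.lTensor A2 (adPartial i) (taylor c D) = taylor c (adPartial i D) := by
  refine tcoeff_ext fun r => ?_
  have h : Commute (adPartial i) (iterAd r) :=
    Commute.mul_right ((adPartial_comm i 0).pow_right _) ((adPartial_comm i 1).pow_right _)
  rw [tcoeff_lTensor, tcoeff_taylor, tcoeff_taylor, map_smul, ← Module.End.mul_apply, h.eq,
    Module.End.mul_apply]

lemma taylor_partialS (c : ℂ) (i : Fin 2) : taylor c (partialS i) = 1 ⊗ₜ partialS i := by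
  rw [← sub_eq_zero]
  refine taylor_unique c _ ?_ fun j => ?_
  · rw [map_sub, tcoeff_zero_taylor, tcoeff_zero_one_tmul, sub_self]
  · have h : taylor c 0 = 0 := map_zero (taylorₗ c)
    simp only [map_sub, pderiv_taylor, lTensor_adPartial_taylor, h, LinearMap.rTensor_tmul,
      LinearMap.lTensor_tmul, adPartial_partial, Derivation.coeFn_coe,
      Derivation.map_one_eq_zero, TensorProduct.zero_tmul, TensorProduct.tmul_zero, sub_zero,
      smul_zero]

/-- The `A₂`-linear extension `f ⊗ D ↦ f • taylor (-1) D` of `taylor (-1)`; it inverts the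
`A₂`-linear extension of `taylor 1`. -/
noncomputable def taylorInv : A2 ⊗[ℂ] Sbar →ₗ[A2] A2 ⊗[ℂ] Sbar :=
  (taylorₗ (-1)).liftBaseChange A2

lemma taylorInv_tmul (f : A2) (D : Sbar) : taylorInv (f ⊗ₜ D) = f • taylor (-1) D := rfl

lemma tcoeff_zero_taylorInv (z : A2 ⊗[ℂ] Sbar) : tcoeff 0 (taylorInv z) = tcoeff 0 z := by
  induction z with
  | zero => simp
  | add y z hy hz => simp only [map_add, hy, hz]
  | tmul f D => rw [taylorInv_tmul, tcoeff_zero_smul, tcoeff_zero_taylor, tcoeff_tmul]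

lemma pderiv_taylorInv (i : Fin 2) (z : A2 ⊗[ℂ] Sbar) :
    LinearMap.rTensor Sbar (pderiv i : W2).toLinearMap (taylorInv z) =
      taylorInv (LinearMap.rTensor Sbar (pderiv i : W2).toLinearMap z -
        LinearMap.lTensor A2 (adPartial i) z) := by
  induction z with
  | zero => simp
  | add y z hy hz => simp only [map_add, map_sub, hy, hz]; abel
  | tmul f D =>
    have hneg (y : A2 ⊗[ℂ] Sbar) : f • ((-1 : ℂ) • y) = -(f • y) := by
      rw [smul_comm]
      exact neg_one_smul ℂ (f • y)
    rw [taylorInv_tmul, rTensor_derivation_smul, pderiv_taylor, lTensor_adPartial_taylor,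
      map_sub, LinearMap.rTensor_tmul, LinearMap.lTensor_tmul, taylorInv_tmul, taylorInv_tmul,
      hneg, sub_eq_add_neg]
    rfl

lemma taylorInv_taylor (D : Sbar) : taylorInv (taylor 1 D) = 1 ⊗ₜ D := by
  rw [← sub_eq_zero]
  refine taylor_unique 0 _ ?_ fun i => ?_
  · rw [map_sub, tcoeff_zero_taylorInv, tcoeff_zero_taylor, tcoeff_zero_one_tmul, sub_self]
  · rw [map_sub, pderiv_taylorInv, pderiv_taylor, one_smul, sub_self, LinearMap.rTensor_tmul]
    simp

end Taylor

section MulMap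

variable {M : Type u} [AddCommGroup M] [Module ℂ M] [LieRingModule Stilde M] [LieModule ℂ Stilde M]
  {a : Fin 2 → ℂ} {W : Type*} [AddCommGroup W] [Module ℂ W]

/-- The map `p ⊗ v ↦ p (j v)` from `A₂ ⊗ W` to `M` given by a linear map `j` from `W` to the
Whittaker vectors of `M`. -/
noncomputable def mulMap (j : W →ₗ[ℂ] Wh M a) : A2 ⊗[ℂ] W →ₗ[ℂ] M :=
  TensorProduct.lift (((LieModule.toEnd ℂ Stilde M : Stilde →ₗ[ℂ] Module.End ℂ M) ∘ₗ
    (inA : A2 →ₗ[ℂ] Stilde)).compl₂ ((Wh M a).subtype ∘ₗ j))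

lemma mulMap_tmul (j : W →ₗ[ℂ] Wh M a) (p : A2) (v : W) :
    mulMap j (p ⊗ₜ v) = ⁅inA p, (j v : M)⁆ := rfl

lemma mulMap_one_tmul (hM : IsASModule M) (j : W →ₗ[ℂ] Wh M a) (v : W) :
    mulMap j (1 ⊗ₜ v) = j v :=
  hM.one_act _

lemma mulMap_smul (hM : IsASModule M) (j : W →ₗ[ℂ] Wh M a) (f : A2) (w : A2 ⊗[ℂ] W) :
    mulMap j (f • w) = ⁅inA f, mulMap j w⁆ := by
  induction w with
  | zero => simp
  | add w w' hw hw' => simp only [smul_add, map_add, lie_add, hw, hw']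
  | tmul p v => rw [TensorProduct.smul_tmul', mulMap_tmul, mulMap_tmul, hM.mul_act, smul_eq_mul]

lemma mulMap_pderiv (j : W →ₗ[ℂ] Wh M a) (i : Fin 2) (w : A2 ⊗[ℂ] W) :
    mulMap j (LinearMap.rTensor W (pderiv i : W2).toLinearMap w) =
      shiftedPartial M a i (mulMap j w) := by
  induction w with
  | zero => simp
  | add w w' hw hw' => simp only [map_add, hw, hw']
  | tmul p v =>
    rw [LinearMap.rTensor_tmul, mulMap_tmul, mulMap_tmul, shiftedPartial_inA,
      mem_Wh_iff.1 (j v).2 i, lie_zero, add_zero]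
    rfl

lemma mulMap_injective (hM : IsASModule M) {j : W →ₗ[ℂ] Wh M a} (hj : Function.Injective j) :
    Function.Injective (mulMap j) := by
  rw [injective_iff_map_eq_zero]
  intro w hw
  obtain ⟨n, hn⟩ := exists_mem_degreeLT w
  induction n generalizing w with
  | zero => exact eq_zero_of_mem_degreeLT_zero hn
  | succ n ih =>
    have hconst : w = 1 ⊗ₜ tcoeff 0 w := eq_one_tmul_of_pderiv_eq_zero fun i =>
      ih _ (by rw [mulMap_pderiv, hw, map_zero]) (pderiv_mem_degreeLT hn i)
    rw [hconst, mulMap_one_tmul hM, ZeroMemClass.coe_eq_zero, map_eq_zero_iff j hj] at hw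
    rw [hconst, hw, TensorProduct.tmul_zero]

lemma mulMap_surjective (hM : IsASModule M) (hT : IsOfType M a) {j : W →ₗ[ℂ] Wh M a}
    (hj : Function.Surjective j) : Function.Surjective (mulMap j) := by
  rw [← LinearMap.range_eq_top]
  refine eq_top_of_Wh_le hM hT (fun m hm => ?_) ?_
  · obtain ⟨v, hv⟩ := hj ⟨m, hm⟩
    exact ⟨1 ⊗ₜ v, by rw [mulMap_one_tmul hM, hv]⟩
  · rintro i _ ⟨w, rfl⟩
    exact ⟨(X i : A2) • w, mulMap_smul hM j _ w⟩

lemma smashAct_taylorInv_taylor (hM : IsASModule M) (D : Sbar) (m : M) :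
    smashAct M (taylorInv (taylor 1 D)) m = ⁅inS D, m⁆ := by
  rw [taylorInv_taylor, smashAct_tmul, hM.one_act]

lemma smashAct_taylorInv_constPart (hM : IsASModule M) (D : Sbar) {m : M} (hm : m ∈ Wh M a) :
    smashAct M (taylorInv (constPart D)) m = ⁅inA (∑ i, a i • D.1 (X i)), m⁆ := by
  simp only [constPart, map_sum, LinearMap.sum_apply, taylorInv_tmul, taylor_partialS,
    ← inA_smashAct hM, smashAct_tmul, lie_partialS_of_mem_Wh hm, lie_smul, sum_lie, map_smul,
    smul_lie, hM.one_act]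
  rfl

variable [LieRingModule SbarGE W] [LieModule ℂ SbarGE W] {j : W →ₗ[ℂ] Wh M a}

lemma mulMap_extAct_one_tmul (hM : IsASModule M)
    (hlie : ∀ (x : SbarGE) (v : W), (j ⁅x, v⁆ : M) = whAct M x.1 (j v))
    (z : A2 ⊗[ℂ] SbarGE) (v : W) : mulMap j (extAct SbarGE W z (1 ⊗ₜ v)) =
      smashAct M (taylorInv (LinearMap.lTensor A2 SbarGE.toSubmodule.subtype z)) (j v) := by
  induction z with
  | zero => simp
  | add y z hy hz => simp only [map_add, LinearMap.add_apply, hy, hz]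
  | tmul f D =>
    rw [extAct_tmul, mul_one, LinearMap.lTensor_tmul, taylorInv_tmul, ← inA_smashAct hM,
      mulMap_tmul, hlie]
    rfl

lemma mulMap_tensorAct_one_tmul (hM : IsASModule M)
    (hlie : ∀ (x : SbarGE) (v : W), (j ⁅x, v⁆ : M) = whAct M x.1 (j v)) (D : Sbar) (v : W) :
    mulMap j (tensorAct a W D (1 ⊗ₜ v)) = ⁅inS D, (j v : M)⁆ := by
  have hfield : mulMap j (LinearMap.rTensor W (twistedField a D.1) (1 ⊗ₜ v)) =
      smashAct M (taylorInv (constPart D)) (j v) := by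
    rw [LinearMap.rTensor_tmul, mulMap_tmul, twistedField_apply, Derivation.map_one_eq_zero,
      zero_add, mul_one, smashAct_taylorInv_constPart hM D (j v).2]
  rw [tensorAct, LinearMap.add_apply, map_add, hfield, mulMap_extAct_one_tmul hM hlie,
    ← LinearMap.add_apply, ← map_add, ← map_add, add_comm, ← taylor_decomp,
    smashAct_taylorInv_taylor hM]

lemma mulMap_tensorAct (hM : IsASModule M)
    (hlie : ∀ (x : SbarGE) (v : W), (j ⁅x, v⁆ : M) = whAct M x.1 (j v)) (D : Sbar)
    (w : A2 ⊗[ℂ] W) : mulMap j (tensorAct a W D w) = ⁅inS D, mulMap j w⁆ := by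
  induction w with
  | zero => simp
  | add w w' hw hw' => simp only [map_add, lie_add, hw, hw']
  | tmul p v =>
    have hp : p ⊗ₜ[ℂ] v = p • ((1 : A2) ⊗ₜ[ℂ] v) := by
      rw [TensorProduct.smul_tmul', smul_eq_mul, mul_one]
    rw [hp, tensorAct_smul_A2, map_add, mulMap_smul hM, mulMap_smul hM, mulMap_smul hM,
      mulMap_tensorAct_one_tmul hM hlie, mulMap_one_tmul hM, inS_inA]

end MulMap

section TensorAct

variable (a : Fin 2 → ℂ) {V : Type*} [AddCommGroup V] [Module ℂ V] [LieRingModule SbarGE V]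
  [LieModule ℂ SbarGE V]

lemma tensorAct_zero : tensorAct a V 0 = 0 := by
  simpa only [zero_smul] using tensorAct_smul (V := V) a 0 0

lemma tensorAct_partialS (i : Fin 2) (w : A2 ⊗[ℂ] V) :
    tensorAct a V (partialS i) w =
      LinearMap.rTensor V (pderiv i : W2).toLinearMap w + a i • w := by
  have hcocycle : cocycle (partialS i) = 0 := by
    rw [cocycle_apply, taylor_partialS, LinearMap.lTensor_tmul, projGE_partialS,
      TensorProduct.tmul_zero]
  have hfield : twistedField a (partialS i).1 = twistedPartial a i := by
    change ∑ j, LinearMap.mulLeft ℂ (pderiv i (X j)) ∘ₗ twistedPartial a j = _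
    rw [Finset.sum_eq_single i (fun j _ hj => ?_) (by simp), pderiv_X_self, LinearMap.mulLeft_one,
      LinearMap.id_comp]
    rw [pderiv_X_of_ne hj, LinearMap.mulLeft_zero_eq_zero, LinearMap.zero_comp]
  rw [tensorAct, hcocycle, hfield, map_zero, add_zero, twistedPartial, LinearMap.rTensor_add,
    LinearMap.rTensor_smul, LinearMap.rTensor_id]
  rfl

lemma tcoeff_zero_tensorAct_one_tmul (D : SbarGE) (v : V) :
    tcoeff 0 (tensorAct a V D.1 (1 ⊗ₜ v)) = ⁅D, v⁆ := by
  have h0 (i : Fin 2) : coeff 0 (D.1.1 (X i)) = 0 := atOrigin_of_mem D.2 i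
  rw [tensorAct, LinearMap.add_apply, map_add, tcoeff_zero_extAct, LinearMap.rTensor_tmul,
    tcoeff_tmul, cocycle_apply, tcoeff_lTensor, tcoeff_zero_taylor, projGE_of_mem,
    twistedField_apply]
  simp [h0]

end TensorAct

section TensorObj

variable (a : Fin 2 → ℂ) (V : LieModCat.{0, u} SbarGE)

/-- The identification of `A₂ ⊗ V` with the underlying space of `T(A₂^a, V)`, used to keep the two
apart. -/
noncomputable def tensorEquiv : A2 ⊗[ℂ] V ≃ₗ[ℂ] tensorObj a V := LinearEquiv.refl ℂ (A2 ⊗[ℂ] V)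

lemma inA_tensorEquiv (f : A2) (w : A2 ⊗[ℂ] V) :
    ⁅inA f, tensorEquiv a V w⁆ = tensorEquiv a V (f • w) := by
  change f • w + tensorAct a V 0 w = f • w
  rw [tensorAct_zero, LinearMap.zero_apply, add_zero]

lemma inS_tensorEquiv (D : Sbar) (w : A2 ⊗[ℂ] V) :
    ⁅inS D, tensorEquiv a V w⁆ = tensorEquiv a V (tensorAct a V D w) := by
  change (0 : A2) • w + tensorAct a V D w = tensorAct a V D w
  rw [zero_smul, zero_add]

lemma shiftedPartial_tensorEquiv (i : Fin 2) (w : A2 ⊗[ℂ] V) :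
    shiftedPartial (tensorObj a V) a i (tensorEquiv a V w) =
      tensorEquiv a V (LinearMap.rTensor V (pderiv i : W2).toLinearMap w) := by
  rw [shiftedPartial_apply, inS_tensorEquiv, tensorAct_partialS, map_add, map_smul,
    add_sub_cancel_right]

lemma isASModule_tensorObj : IsASModule (tensorObj a V) where
  mul_act f g m := by
    obtain ⟨w, rfl⟩ := (tensorEquiv a V).surjective m
    rw [inA_tensorEquiv, inA_tensorEquiv, inA_tensorEquiv, smul_smul]
  one_act m := by
    obtain ⟨w, rfl⟩ := (tensorEquiv a V).surjective m
    rw [inA_tensorEquiv, one_smul]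

lemma isOfType_tensorObj : IsOfType (tensorObj a V) a := by
  intro m x
  obtain ⟨w, rfl⟩ := (tensorEquiv a V).surjective m
  obtain ⟨n, hn⟩ := exists_mem_degreeLT w
  refine ⟨n, ?_⟩
  rw [toEnd_Delta_sub]
  induction n generalizing w with
  | zero => rw [eq_zero_of_mem_degreeLT_zero hn, map_zero, map_zero]
  | succ n ih =>
    have hstep : (∑ i, atOrigin i x.1 • shiftedPartial (tensorObj a V) a i) (tensorEquiv a V w) =
        tensorEquiv a V
          (∑ i, atOrigin i x.1 • LinearMap.rTensor V (pderiv i : W2).toLinearMap w) := by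
      simp only [LinearMap.sum_apply, LinearMap.smul_apply, shiftedPartial_tensorEquiv, map_sum,
        map_smul]
    rw [pow_succ, Module.End.mul_apply, hstep]
    exact ih _ (sum_mem fun i _ => Submodule.smul_mem _ _ (pderiv_mem_degreeLT hn i))

lemma tensorEquiv_mem_Wh_iff {w : A2 ⊗[ℂ] V} :
    tensorEquiv a V w ∈ Wh (tensorObj a V) a ↔ w = 1 ⊗ₜ[ℂ] tcoeff 0 w := by
  simp only [mem_Wh_iff, shiftedPartial_tensorEquiv, map_eq_zero_iff _ (tensorEquiv a V).injective]
  refine ⟨eq_one_tmul_of_pderiv_eq_zero, fun h i => ?_⟩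
  rw [h, LinearMap.rTensor_tmul, Derivation.coeFn_coe, Derivation.map_one_eq_zero,
    TensorProduct.zero_tmul]

lemma one_tmul_mem_Wh (v : V) : tensorEquiv a V (1 ⊗ₜ v) ∈ Wh (tensorObj a V) a := by
  rw [tensorEquiv_mem_Wh_iff, tcoeff_zero_one_tmul]

/-- The map `v ↦ 1 ⊗ v` from `V` to the Whittaker vectors of `T(A₂^a, V)`. -/
noncomputable def toWh : V →ₗ[ℂ] Wh (tensorObj a V) a :=
  LinearMap.codRestrict (Wh (tensorObj a V) a)
    ((tensorEquiv a V).toLinearMap ∘ₗ TensorProduct.mk ℂ A2 V 1) (one_tmul_mem_Wh a V)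

lemma toWh_bijective : Function.Bijective (toWh a V) := by
  constructor
  · intro v v' h
    have h1 : (1 : A2) ⊗ₜ[ℂ] v = (1 : A2) ⊗ₜ[ℂ] v' :=
      (tensorEquiv a V).injective (congrArg Subtype.val h)
    simpa only [tcoeff_zero_one_tmul] using congrArg (tcoeff 0) h1
  · rintro ⟨m, hm⟩
    obtain ⟨w, rfl⟩ := (tensorEquiv a V).surjective m
    have hw := (tensorEquiv_mem_Wh_iff a V).1 hm
    exact ⟨tcoeff 0 w, Subtype.ext (congrArg (tensorEquiv a V) hw.symm)⟩

lemma tcoeff_zero_smashAct (z : A2 ⊗[ℂ] Sbar) (w : A2 ⊗[ℂ] V) :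
    tcoeff 0 ((tensorEquiv a V).symm (smashAct (tensorObj a V) z (tensorEquiv a V w))) =
      tcoeff 0 (tensorAct a V (tcoeff 0 z) w) := by
  induction z with
  | zero => simp [tensorAct_zero]
  | add y z hy hz => simp only [map_add, LinearMap.add_apply, tensorAct_add, hy, hz]
  | tmul f D =>
    rw [smashAct_tmul, inS_tensorEquiv, inA_tensorEquiv, LinearEquiv.symm_apply_apply,
      tcoeff_zero_smul, tcoeff_tmul, tensorAct_smul, LinearMap.smul_apply, map_smul]

-- Both sides are Whittaker vectors, hence determined by their constant coefficients, and in the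
-- constant coefficient of the Taylor sum only the term `r = 0` survives.
lemma whAct_one_tmul (D : SbarGE) (v : V) :
    whAct (tensorObj a V) D.1 (tensorEquiv a V (1 ⊗ₜ v)) = tensorEquiv a V (1 ⊗ₜ ⁅D, v⁆) := by
  have h := whAct_mem a D.1 (one_tmul_mem_Wh a V v)
  rw [← (tensorEquiv a V).apply_symm_apply (whAct _ _ _), tensorEquiv_mem_Wh_iff] at h
  rw [← LinearEquiv.symm_apply_eq, h, whAct, tcoeff_zero_smashAct, tcoeff_zero_taylor,
    tcoeff_zero_tensorAct_one_tmul]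

end TensorObj

lemma exists_equivalence_restrict {C D : Type*} [Category C] [Category D]
    {R : ObjectProperty D} {F : C ⥤ D} {hFR : ∀ X, R (F.obj X)} {G : R.FullSubcategory ⥤ C}
    {e : C ≌ R.FullSubcategory} (hF : e.functor = R.lift F hFR) (hG : e.inverse = G)
    {P : ObjectProperty C} {Q : ObjectProperty D} (hQR : Q ≤ R)
    (hPQ : ∀ X : P.FullSubcategory, Q (F.obj X.obj))
    (hQP : ∀ Y : Q.FullSubcategory, P (G.obj ⟨Y.obj, hQR _ Y.property⟩)) :
    ∃ e' : P.FullSubcategory ≌ Q.FullSubcategory,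
      e'.functor = Q.lift (P.ι ⋙ F) hPQ ∧
      e'.inverse = P.lift (ObjectProperty.ιOfLE hQR ⋙ G) hQP := by
  obtain rfl := hG
  let unit : 𝟭 C ≅ R.lift F hFR ⋙ e.inverse := e.unitIso ≪≫ eqToIso (by rw [hF])
  let counit : e.inverse ⋙ R.lift F hFR ≅ 𝟭 R.FullSubcategory :=
    eqToIso (by rw [hF]) ≪≫ e.counitIso
  refine ⟨CategoryTheory.Equivalence.mk (Q.lift (P.ι ⋙ F) hPQ)
    (P.lift (ObjectProperty.ιOfLE hQR ⋙ e.inverse) hQP)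
    (NatIso.ofComponents (fun X => P.isoMk (unit.app X.obj)) fun f => ?_)
    (NatIso.ofComponents (fun Y => Q.isoMk (R.ι.mapIso (counit.app ⟨Y.obj, hQR _ Y.property⟩)))
      fun f => ?_), rfl, rfl⟩
  · exact P.hom_ext (unit.hom.naturality f.hom)
  · exact Q.hom_ext (congrArg R.ι.map (counit.hom.naturality ((ObjectProperty.ιOfLE hQR).map f)))

section Equivalence

variable (a : Fin 2 → ℂ)

/-- The `(A₂, S̄₂)`-modules of type `φ_a`, with no finiteness condition on the Whittaker vectors. -/
def isASOfType : ObjectProperty (LieModCat.{0, u} Stilde) :=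
  fun M => IsASModule M ∧ IsOfType M a

lemma isASOfType_tensorObj (V : LieModCat.{0, u} SbarGE) : isASOfType a (tensorObj a V) :=
  ⟨isASModule_tensorObj a V, isOfType_tensorObj a V⟩

/-- `Wh_a(M)` as an `S̄₂^{≥0}`-module, for an arbitrary `(A₂, S̄₂)`-module `M`. -/
noncomputable def whModule {M : LieModCat.{0, u} Stilde} (hM : IsASModule M) :
    LieModCat.{0, u} SbarGE :=
  letI := whLieRingModule M a hM
  haveI := whLieModule M a hM
  { carrier := Wh M a }

/-- The identification of the underlying space of `whModule a hM` with `Wh_a(M)`, used to keep the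
two apart. -/
noncomputable def whModuleEquiv {M : LieModCat.{0, u} Stilde} (hM : IsASModule M) :
    whModule a hM ≃ₗ[ℂ] Wh M a := LinearEquiv.refl ℂ (Wh M a)

variable {a} in
lemma map_mem_Wh {M N : LieModCat.{0, u} Stilde} (f : M →ₗ⁅ℂ,Stilde⁆ N) {m : M}
    (hm : m ∈ Wh M a) : f m ∈ Wh N a := fun x => by
  rw [← LieModuleHom.map_lie, hm x, map_smul]

/-- The restriction to Whittaker vectors of a homomorphism of `(A₂, S̄₂)`-modules. -/
noncomputable def whModuleMap {M N : LieModCat.{0, u} Stilde} (hM : IsASModule M)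
    (hN : IsASModule N) (f : M →ₗ⁅ℂ,Stilde⁆ N) : whModule a hM →ₗ⁅ℂ,SbarGE⁆ whModule a hN where
  toLinearMap := f.toLinearMap.restrict (p := Wh M a) (q := Wh N a) fun _ => map_mem_Wh f
  map_lie' {_ m} := Subtype.ext (map_smashAct f _ m.1)

/-- The functor `M ↦ Wh_a(M)` on all `(A₂, S̄₂)`-modules of type `φ_a`. -/
noncomputable def whFunctor : (isASOfType.{u} a).FullSubcategory ⥤ LieModCat.{0, u} SbarGE where
  obj M := whModule a M.property.1
  map {M N} f := whModuleMap a M.property.1 N.property.1 f.hom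
  map_id _ := rfl
  map_comp _ _ := rfl

/-- The homomorphism `V → Wh_a(T(A₂^a, V))`, `v ↦ 1 ⊗ v`. -/
noncomputable def unitHom (V : LieModCat.{0, u} SbarGE) :
    V →ₗ⁅ℂ,SbarGE⁆ whModule a (isASModule_tensorObj a V) where
  toLinearMap := toWh a V
  map_lie' {x v} := Subtype.ext (whAct_one_tmul a V x v).symm

/-- The homomorphism `T(A₂^a, Wh_a(M)) → M`, `p ⊗ v ↦ p v`. -/
noncomputable def counitHom {M : LieModCat.{0, u} Stilde} (hM : IsASModule M) :
    tensorObj a (whModule a hM) →ₗ⁅ℂ,Stilde⁆ M where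
  toLinearMap := mulMap (whModuleEquiv a hM).toLinearMap
  map_lie' := by
    intro s (w : A2 ⊗[ℂ] whModule a hM)
    have hs : s = inA s.left + inS s.right :=
      LieAlgebra.SemiDirectSum.ext (add_zero _).symm (zero_add _).symm
    change mulMap (whModuleEquiv a hM).toLinearMap
      (s.left • w + tensorAct a (whModule a hM) s.right w) = ⁅s, mulMap _ w⁆
    rw [map_add, mulMap_smul hM, mulMap_tensorAct hM fun _ _ => rfl, ← add_lie, ← hs]

lemma counitHom_bijective {M : LieModCat.{0, u} Stilde} (hM : isASOfType a M) :
    Function.Bijective (counitHom a hM.1) :=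
  ⟨mulMap_injective hM.1 (whModuleEquiv a hM.1).injective,
    mulMap_surjective hM.1 hM.2 (whModuleEquiv a hM.1).surjective⟩

/-- The isomorphism of `L`-modules given by a bijective homomorphism. -/
noncomputable def LieModCat.isoOfBijective {L : Type w} [LieRing L] [LieAlgebra ℂ L]
    {M N : LieModCat.{w, u} L} (f : M →ₗ⁅ℂ,L⁆ N) (hf : Function.Bijective f) : M ≅ N where
  hom := f
  inv := f.inverse (Function.surjInv hf.2) (Function.leftInverse_surjInv hf)
    (Function.rightInverse_surjInv hf.2)
  hom_inv_id := LieModuleHom.ext (Function.leftInverse_surjInv hf)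
  inv_hom_id := LieModuleHom.ext (Function.rightInverse_surjInv hf.2)

/-- The functor `V ↦ T(A₂^a, V)` from all `S̄₂^{≥0}`-modules to the `(A₂, S̄₂)`-modules of type
`φ_a`. -/
noncomputable abbrev tensorFunctorASOfType :
    LieModCat.{0, u} SbarGE ⥤ (isASOfType.{u} a).FullSubcategory :=
  (isASOfType a).lift (tensorFunctor a) (isASOfType_tensorObj a)

/-- The natural isomorphism `V ≅ Wh_a(T(A₂^a, V))`. -/
noncomputable def unitNatIso :
    𝟭 (LieModCat.{0, u} SbarGE) ≅ tensorFunctorASOfType a ⋙ whFunctor a :=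
  NatIso.ofComponents
    (fun V => LieModCat.isoOfBijective (unitHom a V) (toWh_bijective a V)) fun _ => rfl

/-- The natural isomorphism `T(A₂^a, Wh_a(M)) ≅ M`. -/
noncomputable def counitNatIso :
    whFunctor a ⋙ tensorFunctorASOfType a ≅ 𝟭 (isASOfType.{u} a).FullSubcategory :=
  NatIso.ofComponents
    (fun M => (isASOfType a).isoMk
      (LieModCat.isoOfBijective (counitHom a M.property.1) (counitHom_bijective a M.property)))
    fun {M N} f => by
      apply ObjectProperty.hom_ext
      refine LieModuleHom.ext fun (w : A2 ⊗[ℂ] whModule a M.property.1) => ?_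
      change mulMap (whModuleEquiv a N.property.1).toLinearMap (LinearMap.lTensor A2
          (whModuleMap a M.property.1 N.property.1 f.hom).toLinearMap w) =
        LieModuleHom.toLinearMap f.hom (mulMap (whModuleEquiv a M.property.1).toLinearMap w)
      induction w with
      | zero => simp only [map_zero]
      | add w w' hw hw' => simp only [map_add, hw, hw']
      | tmul p v => exact (LieModuleHom.map_lie f.hom (inA p) (whModuleEquiv a _ v).1).symm

lemma isOmega_tensorFunctor (V : SbarGEFMod.{u}) :
    isOmega.{u} a ((tensorFunctor.{u} a).obj V.obj) where
  isAS := isASModule_tensorObj a V.obj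
  isWhittaker := (isOfType_tensorObj a V.obj).isWhittakerModule
  isOfType := isOfType_tensorObj a V.obj
  finite :=
    have : FiniteDimensional ℂ V.obj := V.property
    Module.Finite.of_surjective (toWh a V.obj) (toWh_bijective a V.obj).2

lemma isOmega_le_isASOfType : isOmega.{u} a ≤ isASOfType.{u} a :=
  fun _ hM => ⟨hM.isAS, hM.isOfType⟩

end Equivalence

end WhittakerS2

theorem theorem3_general (a : Fin 2 → ℂ) :
    ∃ (h : ∀ V : WhittakerS2.LieModCat.{0, u} WhittakerS2.SbarGE,
        WhittakerS2.isASOfType.{u} a ((WhittakerS2.tensorFunctor.{u} a).obj V))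
      (e : CategoryTheory.Equivalence (WhittakerS2.LieModCat.{0, u} WhittakerS2.SbarGE)
        (WhittakerS2.isASOfType.{u} a).FullSubcategory),
      e.functor = (WhittakerS2.isASOfType.{u} a).lift (WhittakerS2.tensorFunctor.{u} a) h ∧
      e.inverse = WhittakerS2.whFunctor.{u} a :=
  ⟨WhittakerS2.isASOfType_tensorObj a,
    CategoryTheory.Equivalence.mk (WhittakerS2.tensorFunctorASOfType a) (WhittakerS2.whFunctor a)
      (WhittakerS2.unitNatIso a) (WhittakerS2.counitNatIso a), rfl, rfl⟩

theorem theorem3 (a : Fin 2 → ℂ) :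
    ∃ (h : ∀ V : WhittakerS2.SbarGEFMod.{u},
        WhittakerS2.isOmega.{u} a ((WhittakerS2.tensorFunctor.{u} a).obj V.obj))
      (e : CategoryTheory.Equivalence WhittakerS2.SbarGEFMod.{u} (WhittakerS2.Omega.{u} a)),
      e.functor = (WhittakerS2.isOmega.{u} a).lift
        (WhittakerS2.isFiniteDimensional.{u}.ι.comp (WhittakerS2.tensorFunctor.{u} a)) h ∧
      e.inverse = WhittakerS2.whittakerFunctor.{u} a := by
  obtain ⟨_, e, hF, hG⟩ := theorem3_general.{u} a
  exact ⟨WhittakerS2.isOmega_tensorFunctor a, WhittakerS2.exists_equivalence_restrict hF hG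
    (WhittakerS2.isOmega_le_isASOfType a) _ fun M => M.property.finite⟩
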